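/- Work with formal power series over $\mathbb{C}$ in the odd times $t_o=(t_1,t_3,t_5,\dots)$, $x=t_1$, $\partial=\partial_x$, and put $\xi(t_o,\lambda)=\sum_{n\ge0}t_{2n+1}\lambda^{2n+1}$, $[\lambda^{-1}]_o=(\lambda^{-1},\lambda^{-3}/3,\lambda^{-5}/5,\dots)$. For an invertible series $\tau(t_o)$ let $$\psi_\tau(t_o,\lambda)=\Big(1+\tfrac1\lambda\,\partial_x\log\tfrac{\tau(t_o-2[\lambda^{-1}]_o)}{\tau(t_o)}\Big)^{1/2}\,\frac{\tau(t_o-2[\lambda^{-1}]_o)}{\tau(t_o)}\,e^{\xi(t_o,\lambda)}=\sqrt{\frac1{2\lambda}\,\partial_x\Big(\frac{\tau(t_o-2[\lambda^{-1}]_o)}{\tau(t_o)}e^{\xi(t_o,\lambda)}\Big)^2},$$ where the square root is expanded in $\lambda^{-1}$ so that $\psi_\tau=(1+O(\lambda^{-1}))e^{\xi}$. Call $\tau$ a *CKP tau function* if $\tau$ is invertible and $$\mathrm{Res}_\lambda\,\psi_\tau(t_o,\lambda)\,\psi_\tau(t_o',-\lambda)=0 .$$ Write $\psi_\tau=W_\tau(e^{\xi})$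 with $W_\tau=1+\sum_{j\ge1}w_j(t_o)\partial^{-j}$, and let $L_\tau=W_\tau\partial W_\tau^{-1}$ be the corresponding Lax operator. **Theorem.** Let $\tau_{\rm CW}$ be a CKP tau function with Lax operator $L=L_{\tau_{\rm CW}}$, let $q(t_o)$ be a CKP eigenfunction, i.e. $q_{t_n}=(L^n)_{\ge0}(q)$ for all odd $n\geq 1$, and let $\Omega=\Omega(q,q)$ be a squared eigenfunction potential of $q$, i.e. a series with $$\Omega_{t_n}=\mathrm{Res}_\partial\big(\partial^{-1}q\,(L^n)_{\ge0}\,q\,\partial^{-1}\big)\qquad\text{for all odd } n\ge1$$ (such an $\Omega$ is determined up to an additive constant), with $\Omega(0)\ne0$. Then $\Omega$ has a square root, and for each choice of $\Omega^{1/2}$ the series $$\tau^{\{1\}}_{\rm CW}=\Omega(q,q)^{1/2}\,\tau_{\rm CW}$$ is again a CKP tau function; that is, $\psi^{\{1\}}=\psi_{\tau^{\{1\}}_{\rm CW}}$ satisfies $\mathrm{Res}_\lambda\psi^{\{1\}}(t_o,\lambda)\psi^{\{1\}}(t_o',-\lambda)=0$. Moreover $\tau^{\{1\}}_{\rm CW}$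 corresponds to the Darboux transformation $$T[q]=1-\Omega(q,q)^{-1}q\,\partial^{-1}q ,$$ that is, $W_{\tau^{\{1\}}_{\rm CW}}=T[q]\,W_{\tau_{\rm CW}}$ (equivalently $\psi^{\{1\}}=T[q](\psi_{\tau_{\rm CW}})$) and $L_{\tau^{\{1\}}_{\rm CW}}=T[q]\,L\,T[q]^{-1}$. -/

import Mathlib

namespace CKP

/-! ### Formal pseudo-differential operators -/

/-- Formal pseudo-differential operators `∑ a_i ∂^i` (with `i ∈ ℤ` bounded above) whose
coefficients lie in a commutative algebra `A` with derivation `D`, where `∂ a = a ∂ + D a`. -/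
structure PsDO {A : Type*} [CommRing A] [Algebra ℂ A] (D : Derivation ℂ A A) where
  coeff : ℤ → A
  bdd : ∃ N : ℤ, ∀ i, N < i → coeff i = 0

namespace PsDO

variable {A : Type*} [CommRing A] [Algebra ℂ A] {D : Derivation ℂ A A}

@[ext] theorem ext {P Q : PsDO D} (h : ∀ i, P.coeff i = Q.coeff i) : P = Q := by
  cases P; cases Q; congr; exact funext h

instance : Zero (PsDO D) := ⟨⟨fun _ => 0, 0, fun _ _ => rfl⟩⟩

instance : Add (PsDO D) := ⟨fun P Q => ⟨fun i => P.coeff i + Q.coeff i, by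
  obtain ⟨N, hN⟩ := P.bdd
  obtain ⟨M, hM⟩ := Q.bdd
  exact ⟨max N M, fun i hi => by simp [hN i (by omega), hM i (by omega)]⟩⟩⟩

instance : Neg (PsDO D) := ⟨fun P => ⟨fun i => -P.coeff i, by
  obtain ⟨N, hN⟩ := P.bdd
  exact ⟨N, fun i hi => by simp [hN i hi]⟩⟩⟩

/-- The operator `a ∂^i`. -/
noncomputable def monomial (i : ℤ) (a : A) : PsDO D :=
  ⟨fun j => if j = i then a else 0, i, fun j hj => by simp [hj.ne']⟩

noncomputable instance : One (PsDO D) := ⟨monomial 0 1⟩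

/-- Composition, determined by `∂^i b = ∑_{k ≥ 0} (i choose k) D^k(b) ∂^{i-k}` for `i ∈ ℤ`. -/
noncomputable instance : Mul (PsDO D) := ⟨fun P Q =>
  ⟨fun m => ∑ᶠ p : ℤ × ℕ,
      Ring.choose p.1 p.2 • (P.coeff p.1 * (D^[p.2]) (Q.coeff (m - p.1 + p.2))), by
    obtain ⟨N, hN⟩ := P.bdd
    obtain ⟨M, hM⟩ := Q.bdd
    refine ⟨N + M, fun m hm => finsum_eq_zero_of_forall_eq_zero fun p => ?_⟩
    by_cases h : N < p.1
    · simp [hN _ h]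
    · rw [hM _ (by omega), iterate_map_zero]; simp⟩⟩

@[simp] theorem coeff_zero (i : ℤ) : (0 : PsDO D).coeff i = 0 := rfl
@[simp] theorem coeff_add (P Q : PsDO D) (i : ℤ) : (P + Q).coeff i = P.coeff i + Q.coeff i := rfl
@[simp] theorem coeff_neg (P : PsDO D) (i : ℤ) : (-P).coeff i = -P.coeff i := rfl
theorem coeff_monomial (i : ℤ) (a : A) (j : ℤ) :
    (monomial i a : PsDO D).coeff j = if j = i then a else 0 := rfl
theorem coeff_one (j : ℤ) : (1 : PsDO D).coeff j = if j = 0 then 1 else 0 := rfl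
theorem coeff_mul (P Q : PsDO D) (m : ℤ) : (P * Q).coeff m =
    ∑ᶠ p : ℤ × ℕ, Ring.choose p.1 p.2 • (P.coeff p.1 * (D^[p.2]) (Q.coeff (m - p.1 + p.2))) := rfl

theorem iterate_add (k : ℕ) (a b : A) : (D^[k]) (a + b) = (D^[k]) a + (D^[k]) b :=
  iterate_map_add D k a b

theorem iterate_sum {ι : Type*} (k : ℕ) (s : Finset ι) (f : ι → A) :
    (D^[k]) (∑ i ∈ s, f i) = ∑ i ∈ s, (D^[k]) (f i) := by
  classical
  induction s using Finset.induction_on with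
  | empty => simp [iterate_map_zero]
  | insert a s ha ih => rw [Finset.sum_insert ha, Finset.sum_insert ha, iterate_add, ih]

theorem iterate_zsmul (k : ℕ) (n : ℤ) (a : A) : (D^[k]) (n • a) = n • (D^[k]) a := by
  induction k generalizing a with
  | zero => rfl
  | succ k ih => rw [Function.iterate_succ_apply, Function.iterate_succ_apply, map_zsmul, ih]

theorem iterate_mul (n : ℕ) (a b : A) : (D^[n]) (a * b) =
    ∑ p ∈ Finset.HasAntidiagonal.antidiagonal n, (n.choose p.1 : ℤ) • ((D^[p.1]) a * (D^[p.2]) b) := by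
  induction n with
  | zero => simp
  | succ n ih =>
    have h := Finset.sum_antidiagonal_choose_succ_nsmul
      (fun i j => (D^[i]) a * (D^[j]) b) n
    simp only [natCast_zsmul] at ih ⊢
    rw [h, Function.iterate_succ_apply', ih, map_sum, ← Finset.sum_add_distrib]
    refine Finset.sum_congr rfl fun p hp => ?_
    have h1 : n.choose p.1 = n.choose p.2 := by
      rw [← Finset.HasAntidiagonal.mem_antidiagonal.mp hp, Nat.choose_symm_add]
    rw [map_nsmul, Derivation.leibniz, smul_eq_mul, smul_eq_mul, ← h1, ← nsmul_add,
      Function.iterate_succ_apply', Function.iterate_succ_apply']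
    congr 1; ring

theorem coeff_mul_eq (P Q : PsDO D) {N M : ℤ} (hN : ∀ i, N < i → P.coeff i = 0)
    (hM : ∀ i, M < i → Q.coeff i = 0) (n : ℕ) : (P * Q).coeff (N + M - n) =
    ∑ p ∈ Finset.HasAntidiagonal.antidiagonal n, ∑ q ∈ Finset.HasAntidiagonal.antidiagonal p.2,
      Ring.choose (N - p.1) q.2 • (P.coeff (N - p.1) * (D^[q.2]) (Q.coeff (M - q.1))) := by
  classical
  rw [coeff_mul, Finset.sum_sigma']
  let e : (Σ _ : ℕ × ℕ, ℕ × ℕ) → ℤ × ℕ := fun x => (N - x.1.1, x.2.2)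
  have hs : (Function.support fun p : ℤ × ℕ => Ring.choose p.1 p.2 •
      (P.coeff p.1 * (D^[p.2]) (Q.coeff (N + M - n - p.1 + p.2)))) ⊆
      (((Finset.HasAntidiagonal.antidiagonal n).sigma fun p => Finset.HasAntidiagonal.antidiagonal p.2).image e : Finset _) := by
    intro p hp
    have h1 : p.1 ≤ N := by
      by_contra h
      exact hp (by simp [hN p.1 (by omega)])
    have h2 : N + M - n - p.1 + p.2 ≤ M := by
      by_contra h
      refine hp ?_
      simp only
      rw [hM _ (by omega), iterate_map_zero]; simp
    simp only [Finset.coe_image, Set.mem_image, Finset.mem_coe, Finset.mem_sigma,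
      Finset.HasAntidiagonal.mem_antidiagonal]
    refine ⟨⟨((N - p.1).toNat, n - (N - p.1).toNat), (n - (N - p.1).toNat - p.2, p.2)⟩,
      ⟨by simp only; omega, by simp only; omega⟩, ?_⟩
    ext
    · simp only [e]; omega
    · rfl
  rw [finsum_eq_sum_of_support_subset _ hs, Finset.sum_image]
  · refine Finset.sum_congr rfl fun x hx => ?_
    simp only [Finset.mem_sigma, Finset.HasAntidiagonal.mem_antidiagonal] at hx
    simp only [e]
    congr 4
    omega
  · rintro ⟨⟨a, b⟩, c, d⟩ hx ⟨⟨a', b'⟩, c', d'⟩ hy hxy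
    simp only [Finset.coe_sigma, Set.mem_sigma_iff, Finset.mem_coe,
      Finset.HasAntidiagonal.mem_antidiagonal] at hx hy
    simp only [e, Prod.mk.injEq] at hxy
    obtain ⟨h1, h2⟩ := hxy
    have : a = a' := by omega
    subst this h2
    have : b = b' := by omega
    subst this
    have : c = c' := by omega
    subst this
    rfl

theorem mul_bdd {P Q : PsDO D} {N M : ℤ} (hN : ∀ i, N < i → P.coeff i = 0)
    (hM : ∀ i, M < i → Q.coeff i = 0) : ∀ i, N + M < i → (P * Q).coeff i = 0 := by
  refine fun m hm => finsum_eq_zero_of_forall_eq_zero fun p => ?_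
  by_cases h : N < p.1
  · simp [hN _ h]
  · rw [hM _ (by omega), iterate_map_zero]; simp

theorem ext_of_bdd {P Q : PsDO D} (N : ℤ) (hP : ∀ i, N < i → P.coeff i = 0)
    (hQ : ∀ i, N < i → Q.coeff i = 0) (h : ∀ n : ℕ, P.coeff (N - n) = Q.coeff (N - n)) :
    P = Q := by
  ext i
  by_cases hi : N < i
  · rw [hP i hi, hQ i hi]
  · have := h (N - i).toNat
    rwa [show N - ((N - i).toNat : ℤ) = i by omega] at this


theorem choose_identity (x y : ℤ) (k T : ℕ) :
    ∑ q ∈ Finset.HasAntidiagonal.antidiagonal T,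
      Ring.choose x (k + q.1) * ((k + q.1).choose k : ℤ) * Ring.choose y q.2 =
    Ring.choose x k * Ring.choose (x + y - k) T := by
  have h := Ring.add_choose_eq T (Commute.all (x - k) y)
  rw [show x - k + y = x + y - k by ring] at h
  rw [h, Finset.mul_sum]
  refine Finset.sum_congr rfl fun q _ => ?_
  have h2 := Ring.choose_smul_choose x (Nat.le_add_right k q.1)
  rw [Nat.add_sub_cancel_left, nsmul_eq_mul] at h2
  linear_combination Ring.choose y q.2 * h2

open Finset.HasAntidiagonal in
theorem assoc_aux (p q r : ℕ → A) (N M : ℤ) (n : ℕ) :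
    ∑ x ∈ antidiagonal n, ∑ y ∈ antidiagonal x.2, Ring.choose (N + M - x.1) y.2 •
      ((∑ z ∈ antidiagonal x.1, ∑ w ∈ antidiagonal z.2,
        Ring.choose (N - z.1) w.2 • (p z.1 * (D^[w.2]) (q w.1))) * (D^[y.2]) (r y.1)) =
    ∑ x ∈ antidiagonal n, ∑ y ∈ antidiagonal x.2, Ring.choose (N - x.1) y.2 •
      (p x.1 * (D^[y.2]) (∑ z ∈ antidiagonal y.1, ∑ w ∈ antidiagonal z.2,
        Ring.choose (M - z.1) w.2 • (q z.1 * (D^[w.2]) (r w.1)))) := by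
  have hL : ∀ x y z w : ℕ × ℕ, w ∈ antidiagonal z.2 → z ∈ antidiagonal x.1 →
      Ring.choose (N + M - x.1) y.2 •
      ((Ring.choose (N - z.1) w.2 • (p z.1 * (D^[w.2]) (q w.1))) * (D^[y.2]) (r y.1)) =
      ∑ v ∈ antidiagonal y.2, (Ring.choose (N - z.1) (w.2 + v.1) * ((w.2 + v.1).choose w.2 : ℤ) *
        Ring.choose (M - w.1) v.2) • (p z.1 * (D^[w.2]) (q w.1) * (D^[y.2]) (r y.1)) := by
    intro x y z w hw hz
    rw [mem_antidiagonal] at hw hz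
    rw [← Finset.sum_smul, choose_identity, smul_mul_assoc, smul_smul, mul_comm]
    congr 3
    push_cast [← hz, ← hw]
    ring
  have hR : ∀ x y z w : ℕ × ℕ, Ring.choose (N - x.1) y.2 •
      (p x.1 * (D^[y.2]) (Ring.choose (M - z.1) w.2 • (q z.1 * (D^[w.2]) (r w.1)))) =
      ∑ v ∈ antidiagonal y.2, (Ring.choose (N - x.1) y.2 * (y.2.choose v.1 : ℤ) *
        Ring.choose (M - z.1) w.2) • (p x.1 * (D^[v.1]) (q z.1) * (D^[v.2 + w.2]) (r w.1)) := by
    intro x y z w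
    rw [iterate_zsmul, iterate_mul, Finset.smul_sum, Finset.mul_sum, Finset.smul_sum]
    refine Finset.sum_congr rfl fun v _ => ?_
    rw [← Function.iterate_add_apply]
    simp only [zsmul_eq_mul]
    push_cast
    ring
  simp only [Finset.sum_mul, Finset.mul_sum, Finset.smul_sum, iterate_sum, hR]
  rw [Finset.sum_congr rfl fun x hx => Finset.sum_congr rfl fun y hy =>
    Finset.sum_congr rfl fun z hz => Finset.sum_congr rfl fun w hw => hL x y z w hw hz]
  simp only [Finset.sum_sigma']
  refine Finset.sum_nbij'
    (fun a => ⟨(a.2.2.1.1, a.2.2.2.1.1 + a.2.1.1 + a.2.2.2.2.2 + (a.2.2.2.1.2 + a.2.2.2.2.1)),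
      (a.2.2.2.1.1 + (a.2.1.1 + a.2.2.2.2.2), a.2.2.2.1.2 + a.2.2.2.2.1),
      (a.2.2.2.1.1, a.2.1.1 + a.2.2.2.2.2), (a.2.1.1, a.2.2.2.2.2),
      (a.2.2.2.1.2, a.2.2.2.2.1)⟩)
    (fun b => ⟨(b.1.1 + (b.2.2.1.1 + b.2.2.2.2.1), b.2.2.2.1.1 + (b.2.2.2.2.2 + b.2.2.2.1.2)),
      (b.2.2.2.1.1, b.2.2.2.2.2 + b.2.2.2.1.2),
      (b.1.1, b.2.2.1.1 + b.2.2.2.2.1), (b.2.2.1.1, b.2.2.2.2.1),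
      (b.2.2.2.2.2, b.2.2.2.1.2)⟩)
    ?_ ?_ ?_ ?_ ?_
  · rintro ⟨⟨x1, x2⟩, ⟨y1, y2⟩, ⟨z1, z2⟩, ⟨w1, w2⟩, ⟨v1, v2⟩⟩ h
    simp only [Finset.mem_sigma, mem_antidiagonal] at h ⊢
    obtain ⟨h1, h2, h3, h4, h5⟩ := h
    refine ⟨?_, ?_, ?_, ?_, ?_⟩ <;> (try dsimp only) <;> (try omega)
  · rintro ⟨⟨x1, x2⟩, ⟨y1, y2⟩, ⟨z1, z2⟩, ⟨w1, w2⟩, ⟨v1, v2⟩⟩ h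
    simp only [Finset.mem_sigma, mem_antidiagonal] at h ⊢
    obtain ⟨h1, h2, h3, h4, h5⟩ := h
    refine ⟨?_, ?_, ?_, ?_, ?_⟩ <;> (try dsimp only) <;> (try omega)
  · rintro ⟨⟨x1, x2⟩, ⟨y1, y2⟩, ⟨z1, z2⟩, ⟨w1, w2⟩, ⟨v1, v2⟩⟩ h
    simp only [Finset.mem_sigma, mem_antidiagonal] at h
    obtain ⟨h1, h2, h3, h4, h5⟩ := h
    simp only [Sigma.mk.injEq, Prod.mk.injEq, heq_eq_eq, and_true, true_and]
    omega
  · rintro ⟨⟨x1, x2⟩, ⟨y1, y2⟩, ⟨z1, z2⟩, ⟨w1, w2⟩, ⟨v1, v2⟩⟩ h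
    simp only [Finset.mem_sigma, mem_antidiagonal] at h
    obtain ⟨h1, h2, h3, h4, h5⟩ := h
    simp only [Sigma.mk.injEq, Prod.mk.injEq, heq_eq_eq, and_true, true_and]
    omega
  · rintro ⟨⟨x1, x2⟩, ⟨y1, y2⟩, ⟨z1, z2⟩, ⟨w1, w2⟩, ⟨v1, v2⟩⟩ h
    simp only [Finset.mem_sigma, mem_antidiagonal] at h
    obtain ⟨h1, h2, h3, h4, h5⟩ := h
    subst h5
    rfl

theorem mul_assoc' (P Q R : PsDO D) : P * Q * R = P * (Q * R) := by
  obtain ⟨N, hN⟩ := P.bdd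
  obtain ⟨M, hM⟩ := Q.bdd
  obtain ⟨L, hL⟩ := R.bdd
  refine ext_of_bdd (N + M + L) (mul_bdd (mul_bdd hN hM) hL) ?_ fun n => ?_
  · rw [add_assoc]; exact mul_bdd hN (mul_bdd hM hL)
  · rw [coeff_mul_eq _ _ (mul_bdd hN hM) hL, add_assoc N M L,
      coeff_mul_eq _ _ hN (mul_bdd hM hL)]
    simp only [coeff_mul_eq _ _ hN hM, coeff_mul_eq _ _ hM hL]
    exact assoc_aux (fun i => P.coeff (N - i)) (fun i => Q.coeff (M - i))
      (fun i => R.coeff (L - i)) N M n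

theorem one_mul' (P : PsDO D) : 1 * P = P := by
  ext m
  rw [coeff_mul, finsum_eq_single _ ((0 : ℤ), 0)]
  · simp [coeff_one]
  · rintro ⟨i, k⟩ h
    by_cases hi : i = 0
    · subst hi
      have hk : 0 < k := Nat.pos_of_ne_zero fun h' => h (by rw [h'])
      simp [Ring.choose_zero_pos ℤ hk]
    · simp [coeff_one, hi]

theorem iterate_one (k : ℕ) (hk : k ≠ 0) : (D^[k]) (1 : A) = 0 := by
  obtain ⟨k, rfl⟩ := Nat.exists_eq_succ_of_ne_zero hk
  rw [Function.iterate_succ_apply, Derivation.map_one_eq_zero, iterate_map_zero]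

theorem mul_one' (P : PsDO D) : P * 1 = P := by
  ext m
  rw [coeff_mul, finsum_eq_single _ (m, 0)]
  · simp [coeff_one]
  · rintro ⟨i, k⟩ h
    by_cases hi : m - i + k = 0
    · have hk : k ≠ 0 := by
        rintro rfl
        exact h (by ext <;> simp; omega)
      simp [coeff_one, hi, iterate_one k hk]
    · simp [coeff_one, hi, iterate_map_zero]

theorem add_mul' (P Q R : PsDO D) : (P + Q) * R = P * R + Q * R := by
  obtain ⟨N, hN⟩ := P.bdd
  obtain ⟨M, hM⟩ := Q.bdd
  obtain ⟨L, hL⟩ := R.bdd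
  have h1 : ∀ i, max N M < i → P.coeff i = 0 := fun i hi => hN i (by omega)
  have h2 : ∀ i, max N M < i → Q.coeff i = 0 := fun i hi => hM i (by omega)
  have h3 : ∀ i, max N M < i → (P + Q).coeff i = 0 := fun i hi => by simp [h1 i hi, h2 i hi]
  refine ext_of_bdd (max N M + L) (mul_bdd h3 hL)
    (fun i hi => by simp [mul_bdd h1 hL i hi, mul_bdd h2 hL i hi]) fun n => ?_
  rw [coeff_add, coeff_mul_eq _ _ h3 hL, coeff_mul_eq _ _ h1 hL, coeff_mul_eq _ _ h2 hL]
  simp only [coeff_add, add_mul, smul_add, Finset.sum_add_distrib]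

theorem mul_add' (R P Q : PsDO D) : R * (P + Q) = R * P + R * Q := by
  obtain ⟨N, hN⟩ := P.bdd
  obtain ⟨M, hM⟩ := Q.bdd
  obtain ⟨L, hL⟩ := R.bdd
  have h1 : ∀ i, max N M < i → P.coeff i = 0 := fun i hi => hN i (by omega)
  have h2 : ∀ i, max N M < i → Q.coeff i = 0 := fun i hi => hM i (by omega)
  have h3 : ∀ i, max N M < i → (P + Q).coeff i = 0 := fun i hi => by simp [h1 i hi, h2 i hi]
  refine ext_of_bdd (L + max N M) (mul_bdd hL h3)
    (fun i hi => by simp [mul_bdd hL h1 i hi, mul_bdd hL h2 i hi]) fun n => ?_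
  rw [coeff_add, coeff_mul_eq _ _ hL h3, coeff_mul_eq _ _ hL h1, coeff_mul_eq _ _ hL h2]
  simp only [coeff_add, iterate_add, mul_add, smul_add, Finset.sum_add_distrib]

noncomputable instance : Ring (PsDO D) where
  add_assoc P Q R := by ext i; simp [add_assoc]
  zero_add P := by ext i; simp
  add_zero P := by ext i; simp
  add_comm P Q := by ext i; simp [add_comm]
  neg_add_cancel P := by ext i; simp
  nsmul := nsmulRec
  zsmul := zsmulRec
  mul_assoc := mul_assoc'
  one_mul := one_mul'
  mul_one := mul_one'
  left_distrib := mul_add'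
  right_distrib := add_mul'
  zero_mul P := by
    ext m
    rw [coeff_mul, finsum_eq_zero_of_forall_eq_zero]
    · rfl
    · intro p; simp
  mul_zero P := by
    ext m
    rw [coeff_mul, finsum_eq_zero_of_forall_eq_zero]
    · rfl
    · intro p; simp [iterate_map_zero]


/-- The function `a`, as an operator of multiplication. -/
noncomputable def ofFun (a : A) : PsDO D := monomial 0 a

/-- The operator `∂^i`. -/
noncomputable def del (i : ℤ) : PsDO D := monomial i 1

/-- The differential part `(∑ a_i ∂^i)_{≥0} = ∑_{i≥0} a_i ∂^i`. -/
def nonneg (P : PsDO D) : PsDO D :=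
  ⟨fun i => if 0 ≤ i then P.coeff i else 0, by
    obtain ⟨N, hN⟩ := P.bdd
    exact ⟨N, fun i hi => by simp [hN i hi]⟩⟩

/-- `Res_∂`, the coefficient of `∂⁻¹`. -/
def res (P : PsDO D) : A := P.coeff (-1)

/-- The action `∑_{i≥0} a_i ∂^i(f)` of a differential operator on a function. -/
noncomputable def apply (P : PsDO D) (f : A) : A := ∑ᶠ i : ℕ, P.coeff i * (D^[i]) f

end PsDO

/-! ### Formal power series in the odd times -/

/-- Functions of `t_o = (t₁, t₃, t₅, …)`: formal power series, the variable with index `n`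
being `t_{2n+1}`; in particular the variable with index `0` is `x = t₁`. -/
abbrev TimeSeries := MvPowerSeries ℕ ℂ

/-- Formal power series in `z = λ⁻¹` (the variable `none`) and the odd times
`t_{2n+1}` (the variable `some n`). -/
abbrev LamSeries := MvPowerSeries (Option ℕ) ℂ

/-- Formal power series in two independent sets of odd times `t_o` (`Sum.inl`) and `t_o'`
(`Sum.inr`). -/
abbrev PairSeries := MvPowerSeries (ℕ ⊕ ℕ) ℂ

/-- The partial derivative with respect to `t_{2n+1}`. -/
noncomputable abbrev dt (n : ℕ) : Derivation ℂ TimeSeries TimeSeries := MvPowerSeries.pderiv ℂ n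

/-- Pseudo-differential operators in `∂ = ∂_x` with coefficients depending on the odd times. -/
abbrev Op := PsDO (dt 0)

/-- `λ⁻¹` -/
noncomputable def lamInv : LamSeries := MvPowerSeries.X none

/-- A function of `t_o` regarded as a function of `t_o` and `λ` (constant in `λ`). -/
noncomputable def incl (f : TimeSeries) : LamSeries :=
  MvPowerSeries.rename (Function.Embedding.some : ℕ ↪ Option ℕ) f

/-- `t_{2n+1} - 2 λ^{-(2n+1)}/(2n+1)`, the component with index `n` of `t_o - 2[λ⁻¹]_o`. -/
noncomputable def shiftedTime (n : ℕ) : LamSeries :=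
  MvPowerSeries.X (some n) - ((2 : ℂ) / (2 * n + 1)) • lamInv ^ (2 * n + 1)

/-- `f(t_o - 2[λ⁻¹]_o)` -/
noncomputable def shift (f : TimeSeries) : LamSeries := MvPowerSeries.subst shiftedTime f

theorem hasSubst_shiftedTime : MvPowerSeries.HasSubst shiftedTime where
  const_coeff n := by simp [shiftedTime, lamInv]
  coeff_zero d := by
    classical
    refine ((d.some.support).finite_toSet.union
      (Set.finite_Iic (d none))).subset fun n hn => ?_
    by_contra h
    simp only [Set.mem_union, Finset.mem_coe, Finsupp.mem_support_iff, Finsupp.some_apply,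
      Set.mem_Iic, not_or, not_not, not_le] at h
    refine hn ?_
    have h1 : d ≠ Finsupp.single (some n) 1 := by
      rintro rfl
      simp at h
    have h2 : d ≠ Finsupp.single none (2 * n + 1) := by
      rintro rfl
      simp at h
      omega
    rw [shiftedTime, lamInv, map_sub, map_smul, MvPowerSeries.coeff_X, MvPowerSeries.coeff_X_pow,
      if_neg h1, if_neg h2, smul_zero, sub_zero]

/-- The square root of a series with constant term `1`, given by the binomial series
`(1 + u)^{1/2}`. -/
noncomputable def sqrtOne (f : LamSeries) : LamSeries :=
  PowerSeries.subst (f - 1) (PowerSeries.binomialSeries ℂ (1 / 2 : ℂ))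

theorem sqrtOne_sq (f : LamSeries) (hf : MvPowerSeries.constantCoeff f = 1) :
    sqrtOne f ^ 2 = f := by
  have h : PowerSeries.HasSubst (f - 1) :=
    PowerSeries.HasSubst.of_constantCoeff_zero (by simp [hf])
  rw [sqrtOne, ← PowerSeries.subst_pow h, sq, ← PowerSeries.binomialSeries_add]
  have h2 : (1 / 2 + 1 / 2 : ℂ) = ((1 : ℕ) : ℂ) := by norm_num
  rw [h2, PowerSeries.binomialSeries_nat, pow_one, PowerSeries.subst_add h, PowerSeries.subst_X h,
    ← PowerSeries.coe_substAlgHom h, map_one]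
  ring

/-! ### Wave functions and the bilinear identity -/

/-- The factor `τ(t_o - 2[λ⁻¹]_o) / τ(t_o)`. -/
noncomputable def tauRatio (τ : TimeSeries) : LamSeries := shift τ * (incl τ)⁻¹

/-- The Chang–Wu formula: `cwWave τ * e^{ξ(t_o,λ)}` is the function
`ψ = (1 + λ⁻¹ ∂_x log (τ(t_o - 2[λ⁻¹]_o)/τ(t_o)))^{1/2} τ(t_o - 2[λ⁻¹]_o)/τ(t_o) e^{ξ(t_o,λ)}`. -/
noncomputable def cwWave (τ : TimeSeries) : LamSeries :=
  sqrtOne (1 + lamInv * (MvPowerSeries.pderiv ℂ (some 0) (tauRatio τ) * (tauRatio τ)⁻¹)) *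
    tauRatio τ

/-- The second form of the Chang–Wu formula, `ψ² = (2λ)⁻¹ ∂_x (φ²)` with
`φ = tauRatio τ * e^{ξ(t_o,λ)}`; after division by `e^{2ξ}` it reads as follows. -/
theorem cwWave_sq (τ : TimeSeries) (hτ : MvPowerSeries.constantCoeff τ ≠ 0) :
    cwWave τ ^ 2 = tauRatio τ ^ 2 +
      (1 / 2 : ℂ) • (lamInv * MvPowerSeries.pderiv ℂ (some 0) (tauRatio τ ^ 2)) := by
  have hc : MvPowerSeries.constantCoeff (tauRatio τ) ≠ 0 := by
    have h1 : MvPowerSeries.constantCoeff (shift τ) = MvPowerSeries.constantCoeff τ := by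
      have h2 := MvPowerSeries.constantCoeff_subst_eq_zero hasSubst_shiftedTime
        (fun n => by simp [shiftedTime, lamInv])
        (f := τ - MvPowerSeries.C (MvPowerSeries.constantCoeff τ)) (by simp)
      rw [MvPowerSeries.subst_sub hasSubst_shiftedTime, map_sub, MvPowerSeries.subst_C,
        MvPowerSeries.constantCoeff_C, sub_eq_zero] at h2
      exact h2
    simp [tauRatio, h1, incl, hτ]
  have hinv := MvPowerSeries.mul_inv_cancel _ hc
  rw [cwWave, mul_pow, sqrtOne_sq _ (by simp [lamInv]), Derivation.leibniz_pow]
  have h2 : ((1 / 2 : ℂ) • (2 : LamSeries)) = 1 := by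
    rw [show (2 : LamSeries) = (2 : ℂ) • (1 : LamSeries) by
      rw [← Nat.cast_ofNat, ← Nat.cast_ofNat (R := ℂ), Nat.cast_smul_eq_nsmul, nsmul_eq_mul,
        mul_one], smul_smul]
    norm_num
  generalize MvPowerSeries.pderiv ℂ (some 0) (tauRatio τ) = y at *
  generalize (tauRatio τ)⁻¹ = v at *
  generalize tauRatio τ = u at *
  have h3 : (1 / 2 : ℂ) • (lamInv * (2 • u ^ (2 - 1) • y)) = lamInv * u * y := by
    rw [nsmul_eq_mul, smul_eq_mul, Nat.cast_ofNat, pow_one,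
      show lamInv * (2 * (u * y)) = 2 * (lamInv * u * y) by ring, ← smul_mul_assoc, h2, one_mul]
  rw [h3]
  linear_combination lamInv * y * u * hinv

/-- The coefficient of `λ^{-j}`. -/
noncomputable def lamCoeff (w : LamSeries) (j : ℕ) : TimeSeries :=
  PowerSeries.coeff j (MvPowerSeries.optionEquivLeft ℕ ℂ w)

/-- The coefficients `h_n(t_o)` of `e^{ξ(t_o,λ)} = ∑ h_n(t_o) λ^n`, where
`ξ(t_o,λ) = ∑ t_{2k+1} λ^{2k+1}`: the sum of `∏ t_{2k+1}^{a k} / (a k)!` over all `a` with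
`∑ (2k+1) a k = n`. -/
noncomputable def expCoeff (n : ℕ) : TimeSeries := fun a =>
  if (a.sum fun k e => (2 * k + 1) * e) = n then a.prod fun _ e => ((e.factorial : ℂ))⁻¹ else 0

/-- The coefficient `h_n(t_o - t_o')` of `λ^n` in `e^{ξ(t_o,λ) - ξ(t_o',λ)}`. -/
noncomputable def expCoeffDiff (n : ℕ) : PairSeries :=
  MvPowerSeries.subst (fun k => (MvPowerSeries.X (Sum.inl k) - MvPowerSeries.X (Sum.inr k) :
    PairSeries)) (expCoeff n)

theorem hasSubst_diff : MvPowerSeries.HasSubst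
    (fun k : ℕ => (MvPowerSeries.X (Sum.inl k) - MvPowerSeries.X (Sum.inr k) : PairSeries)) where
  const_coeff n := by simp
  coeff_zero d := by
    classical
    refine ((d.support.preimage Sum.inl Sum.inl_injective.injOn).finite_toSet.union
      (d.support.preimage Sum.inr Sum.inr_injective.injOn).finite_toSet).subset fun n hn => ?_
    by_contra h
    simp only [Set.mem_union, Finset.mem_coe, Finset.mem_preimage, Finsupp.mem_support_iff,
      not_or, not_not] at h
    refine hn ?_
    have h1 : d ≠ Finsupp.single (Sum.inl n) 1 := by
      rintro rfl
      simp at h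
    have h2 : d ≠ Finsupp.single (Sum.inr n) 1 := by
      rintro rfl
      simp at h
    simp [MvPowerSeries.coeff_X, h1, h2]

/-- The weight of a monomial in `t_o, t_o'`, where `t_{2k+1}` and `t_{2k+1}'` have weight
`2k+1`. -/
def pairWeight : ℕ ⊕ ℕ → ℕ := Sum.elim (fun k => 2 * k + 1) (fun k => 2 * k + 1)

theorem coeff_expCoeffDiff (n : ℕ) (m : ℕ ⊕ ℕ →₀ ℕ) (hm : Finsupp.weight pairWeight m ≠ n) :
    MvPowerSeries.coeff m (expCoeffDiff n) = 0 := by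
  rw [expCoeffDiff, MvPowerSeries.coeff_subst hasSubst_diff]
  refine finsum_eq_zero_of_forall_eq_zero fun d => ?_
  by_cases hd : (d.sum fun k e => (2 * k + 1) * e) = n
  · have h1 : MvPolynomial.IsWeightedHomogeneous pairWeight (∏ k ∈ d.support,
        (MvPolynomial.X (Sum.inl k) - MvPolynomial.X (Sum.inr k) :
          MvPolynomial (ℕ ⊕ ℕ) ℂ) ^ d k) (∑ k ∈ d.support, d k • (2 * k + 1)) := by
      refine MvPolynomial.IsWeightedHomogeneous.prod _ _ _ fun k _ => ?_
      refine MvPolynomial.IsWeightedHomogeneous.pow ?_ _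
      exact Submodule.sub_mem (MvPolynomial.weightedHomogeneousSubmodule ℂ pairWeight (2 * k + 1))
        (MvPolynomial.isWeightedHomogeneous_X ℂ pairWeight (Sum.inl k))
        (MvPolynomial.isWeightedHomogeneous_X ℂ pairWeight (Sum.inr k))
    have h2 : (∑ k ∈ d.support, d k • (2 * k + 1)) = n := by
      rw [← hd, Finsupp.sum]
      exact Finset.sum_congr rfl fun k _ => by rw [smul_eq_mul, mul_comm]
    rw [h2] at h1
    have h3 : (d.prod fun k e => (MvPowerSeries.X (Sum.inl k) - MvPowerSeries.X (Sum.inr k) :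
        PairSeries) ^ e) = ((∏ k ∈ d.support,
        (MvPolynomial.X (Sum.inl k) - MvPolynomial.X (Sum.inr k) :
          MvPolynomial (ℕ ⊕ ℕ) ℂ) ^ d k : MvPolynomial (ℕ ⊕ ℕ) ℂ) : PairSeries) := by
      rw [← MvPolynomial.coeToMvPowerSeries.ringHom_apply, map_prod, Finsupp.prod]
      refine Finset.prod_congr rfl fun k _ => ?_
      rw [map_pow, map_sub, MvPolynomial.coeToMvPowerSeries.ringHom_apply,
        MvPolynomial.coeToMvPowerSeries.ringHom_apply, MvPolynomial.coe_X, MvPolynomial.coe_X]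
    rw [h3, MvPolynomial.coeff_coe, h1.coeff_eq_zero m hm, smul_zero]
  · rw [show MvPowerSeries.coeff d (expCoeff n) = 0 from if_neg hd, zero_smul]

/-- The sum over `n` in the residue is finite for every monomial. -/
theorem coeff_expCoeffDiff_mul (n : ℕ) (F : PairSeries) (m : ℕ ⊕ ℕ →₀ ℕ)
    (hm : Finsupp.weight pairWeight m < n) :
    MvPowerSeries.coeff m (expCoeffDiff n * F) = 0 := by
  classical
  rw [MvPowerSeries.coeff_mul]
  refine Finset.sum_eq_zero fun p hp => ?_
  rw [Finset.HasAntidiagonal.mem_antidiagonal] at hp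
  rw [coeff_expCoeffDiff n p.1, zero_mul]
  rw [← hp, map_add] at hm
  omega

/-- The coefficient of `λ^{-(n+1)}` in `u(t_o,λ) v(t_o',-λ)`. -/
noncomputable def pairCoeff (u v : LamSeries) (n : ℕ) : PairSeries :=
  ∑ p ∈ Finset.HasAntidiagonal.antidiagonal (n + 1), (-1 : ℂ) ^ p.2 •
    (MvPowerSeries.rename (Function.Embedding.inl : ℕ ↪ ℕ ⊕ ℕ) (lamCoeff u p.1) *
      MvPowerSeries.rename (Function.Embedding.inr : ℕ ↪ ℕ ⊕ ℕ) (lamCoeff v p.2))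

/-- `Res_λ ψ(t_o,λ) χ(t_o',-λ)` for `ψ = u e^{ξ}` and `χ = v e^{ξ}`, i.e. the coefficient of
`λ⁻¹` in `u(t_o,λ) v(t_o',-λ) e^{ξ(t_o,λ) - ξ(t_o',λ)}`, which is
`∑ₙ h_n(t_o - t_o') · pairCoeff u v n`.  Only finitely many `n` contribute to a given
monomial, by `coeff_expCoeffDiff_mul`. -/
noncomputable def lamRes (u v : LamSeries) : PairSeries := fun m =>
  ∑ᶠ n : ℕ, MvPowerSeries.coeff m (expCoeffDiff n * pairCoeff u v n)

/-- `τ` is a CKP tau function in the sense of Chang and Wu: it is invertible and the wave function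
`ψ` defined from it by the Chang–Wu formula satisfies `Res_λ ψ(t_o,λ) ψ(t_o',-λ) = 0`. -/
def IsCKPTau (τ : TimeSeries) : Prop :=
  MvPowerSeries.constantCoeff τ ≠ 0 ∧ lamRes (cwWave τ) (cwWave τ) = 0

/-! ### Lax operator, eigenfunctions, squared eigenfunction potential -/

/-- The operator `W = ∑ w_j ∂^{-j}` attached to `w = ∑ w_j λ^{-j}`; thus
`W(e^{ξ(t_o,λ)}) = w(t_o,λ) e^{ξ(t_o,λ)}`. -/
noncomputable def symbolOp (w : LamSeries) : Op :=
  ⟨fun i => if i ≤ 0 then lamCoeff w (-i).toNat else 0, 0, fun i hi => by simp [hi.not_ge]⟩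

/-- The dressing operator of a tau function: `ψ = W(e^ξ)` with `ψ` given by the Chang–Wu formula. -/
noncomputable def dressing (τ : TimeSeries) : Op := symbolOp (cwWave τ)

/-- The Lax operator `L = W ∂ W⁻¹`. -/
noncomputable def lax (τ : TimeSeries) : Op :=
  dressing τ * PsDO.del 1 * Ring.inverse (dressing τ)

/-- `q` is an eigenfunction: `q_{t_n} = (L^n)_{≥0}(q)` for all odd `n`. -/
def IsEigenfunction (L : Op) (q : TimeSeries) : Prop :=
  ∀ n : ℕ, dt n q = ((L ^ (2 * n + 1)).nonneg).apply q

/-- `Ω` is a squared eigenfunction potential `Ω(q, r)`: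
`Ω_{t_n} = Res_∂ (∂⁻¹ r (L^n)_{≥0} q ∂⁻¹)` for all odd `n`.  This determines `Ω` up to an
additive constant. -/
def IsSEP (L : Op) (q r Ω : TimeSeries) : Prop :=
  ∀ n : ℕ, dt n Ω = (PsDO.del (-1) * PsDO.ofFun r * (L ^ (2 * n + 1)).nonneg * PsDO.ofFun q *
    PsDO.del (-1)).res

/-- The Darboux transformation operator `T[q] = 1 - Ω⁻¹ q ∂⁻¹ q`. -/
noncomputable def darbouxOp (q Ω : TimeSeries) : Op :=
  1 - PsDO.ofFun (Ω⁻¹ * q) * PsDO.del (-1) * PsDO.ofFun q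

end CKP

/-!
A wave function `ψ = W(e^ξ)` is represented by the operator `W` throughout, so that functions of
`t_o` and the differential operators in `∂` act by left multiplication, and `∂_{t_{2n+1}}` acts by
`flow n W = W_{t_{2n+1}} + W ∂^{2n+1}`. The basic object is the residue
`bilinRes U V = Res_λ U(e^ξ)(t_o, λ) V(e^ξ)(t_o', -λ)`, a series in two sets of times.

Let `Φ = Ω(q, ψ)` be the wave function of `∂⁻¹ q W`, so that the Darboux transform of `ψ` is
`ψ - Ω⁻¹ q Φ`. The proof rests on three identities:
* `Res_λ ψ(t_o, λ) Φ(t_o', -λ) = -q(t_o)` (`bilinRes_potentialOp_right`),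
* `Res_λ Φ(t_o, λ) ψ(t_o', -λ) = q(t_o')` (`bilinRes_potentialOp_left`),
* `Res_λ Φ(t_o, λ) Φ(t_o', -λ) = Ω(t_o') - Ω(t_o)` (`bilinRes_potentialOp_potentialOp`).

They are proved by differentiating and comparing values on the diagonal `t_o' = t_o`, where only
leading coefficients contribute to the residue. The derivatives come from the Sato–Wilson equations
(`IsCKPDressing.flow_eq`), a consequence of the bilinear identity of `ψ`, and from the fact
that `Φ_{t_n}` is a differential operator applied to `ψ` (`potentialFlow_eq_nonneg`). The latter is
where `q` being an eigenfunction enters; it replaces the skew-adjointness of `(L^n)_{≥0}`.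

The bilinear identity of `ψ - Ω⁻¹ q Φ` follows by expanding the product and inserting the
three identities (`bilinRes_darbouxOp_mul`). For the tau function, put `t_o' = t_o - 2[μ⁻¹]_o`,
where the exponential factor of the residue becomes `(1 + λ/μ) / (1 - λ/μ)`, and the residue is, up
to its first terms, the product of the two symbols at `λ = μ` (`lamInv_mul_miwaHom_bilinRes`). This
expresses the symbol of `Φ` and the difference `Ω(t_o) - Ω(t_o - 2[λ⁻¹]_o)` through `q`, its shift
and `ψ`. Since `ψ(t_o, λ) ψ(t_o - 2[λ⁻¹]_o, -λ)` is, without the exponentials, the factor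
`1 + λ⁻¹ ∂_x log (τ(t_o - 2[λ⁻¹]_o) / τ(t_o))` (`cwWave_mul_flipHom`), one finds that the square of
`ψ - Ω⁻¹ q Φ` is the square of the Chang–Wu wave function of `Ω^{1/2} τ` (`cwWave_mul_eq`); both are
normalized, hence equal.

Infinite sums of power series are taken in the topology of coefficientwise convergence, in which
all the families occurring here have only finitely many terms in each coefficient.
-/

open scoped MvPowerSeries.WithPiTopology

namespace CKP

/-! ### Continuity of substitutions and derivatives of power series -/

section PowerSeriesCalculus

variable {σ τ : Type*}

theorem continuous_subst {a : σ → MvPowerSeries τ ℂ} (ha : MvPowerSeries.HasSubst a) :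
    Continuous (MvPowerSeries.subst a : MvPowerSeries σ ℂ → MvPowerSeries τ ℂ) := by
  refine continuous_pi fun e => ?_
  -- the monomials contributing to the coefficient of `e` are those contributing for `f = ∑ X^d`
  obtain ⟨g, hg⟩ : ∃ g : MvPowerSeries σ ℂ, ∀ d, MvPowerSeries.coeff d g = 1 :=
    ⟨fun _ => 1, fun _ => rfl⟩
  have hfin := MvPowerSeries.coeff_subst_finite ha g e
  have h1 : ∀ f : MvPowerSeries σ ℂ, MvPowerSeries.subst a f e = ∑ d ∈ hfin.toFinset,
      MvPowerSeries.coeff d f • MvPowerSeries.coeff e (d.prod fun s n => a s ^ n) := by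
    intro f
    refine (MvPowerSeries.coeff_subst ha f e).trans (finsum_eq_sum_of_support_subset _ ?_)
    intro d hd
    have h2 : MvPowerSeries.coeff e (d.prod fun s n => a s ^ n) ≠ 0 := fun h => hd (by simp [h])
    refine Finset.mem_coe.mpr ((Set.Finite.mem_toFinset hfin).mpr ?_)
    change MvPowerSeries.coeff d g • _ ≠ 0
    rwa [hg, one_smul]
  simp only [h1]
  exact continuous_finsetSum _ fun d _ =>
    (MvPowerSeries.WithPiTopology.continuous_coeff ℂ d).smul continuous_const

theorem continuous_substAlgHom {a : σ → MvPowerSeries τ ℂ} (ha : MvPowerSeries.HasSubst a) :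
    Continuous (MvPowerSeries.substAlgHom (R := ℂ) ha) := by
  rw [MvPowerSeries.coe_substAlgHom]
  exact continuous_subst ha

theorem continuous_rename (e : σ ↪ τ) :
    Continuous (MvPowerSeries.rename (R := ℂ) e) := by
  have h : (MvPowerSeries.rename (R := ℂ) e : MvPowerSeries σ ℂ → MvPowerSeries τ ℂ) =
      MvPowerSeries.subst (MvPowerSeries.X ∘ e) := funext fun f => MvPowerSeries.rename_eq_subst e f
  rw [h]
  exact continuous_subst (MvPowerSeries.HasSubst.X_comp e)

theorem continuous_pderiv (k : σ) : Continuous (MvPowerSeries.pderiv ℂ k) := by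
  refine continuous_pi fun d => ?_
  have h : ∀ f : MvPowerSeries σ ℂ, MvPowerSeries.pderiv ℂ k f d =
      MvPowerSeries.coeff (d + Finsupp.single k 1) f * (d k + 1) :=
    fun f => MvPowerSeries.coeff_pderiv f d
  simp only [h]
  exact (MvPowerSeries.WithPiTopology.continuous_coeff ℂ _).mul continuous_const

/-- Two continuous maps agree on power series as soon as they agree on polynomials. -/
theorem eq_of_eq_on_polynomials {Y : Type*} [TopologicalSpace Y] [T2Space Y]
    {F G : MvPowerSeries σ ℂ → Y} (hF : Continuous F) (hG : Continuous G)
    (h : ∀ p : MvPolynomial σ ℂ, F p = G p) (f : MvPowerSeries σ ℂ) : F f = G f := by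
  have := MvPowerSeries.WithPiTopology.denseRange_toMvPowerSeries (σ := σ) (R := ℂ)
  exact congrFun (this.equalizer hF hG (funext h)) f

theorem algHom_eq_of_eq_X {φ ψ : MvPowerSeries σ ℂ →ₐ[ℂ] MvPowerSeries τ ℂ}
    (hφ : Continuous φ) (hψ : Continuous ψ)
    (h : ∀ s, φ (MvPowerSeries.X s) = ψ (MvPowerSeries.X s)) (f : MvPowerSeries σ ℂ) :
    φ f = ψ f := by
  refine eq_of_eq_on_polynomials hφ hψ (fun p => ?_) f
  have : (φ.comp (MvPolynomial.coeToMvPowerSeries.algHom ℂ)) =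
      (ψ.comp (MvPolynomial.coeToMvPowerSeries.algHom ℂ)) := by
    refine MvPolynomial.algHom_ext fun s => ?_
    simpa using h s
  simpa using DFunLike.congr_fun this p

/-- The chain rule for a continuous homomorphism `φ` of power series algebras such that only
finitely many of the series `φ X_s` depend on the variable `k`. -/
theorem pderiv_algHom {φ : MvPowerSeries σ ℂ →ₐ[ℂ] MvPowerSeries τ ℂ} (hφ : Continuous φ)
    (k : τ) (S : Finset σ) (hS : ∀ s ∉ S, MvPowerSeries.pderiv ℂ k (φ (MvPowerSeries.X s)) = 0)
    (f : MvPowerSeries σ ℂ) :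
    MvPowerSeries.pderiv ℂ k (φ f) = ∑ s ∈ S,
      MvPowerSeries.pderiv ℂ k (φ (MvPowerSeries.X s)) * φ (MvPowerSeries.pderiv ℂ s f) := by
  classical
  refine eq_of_eq_on_polynomials (F := fun f => MvPowerSeries.pderiv ℂ k (φ f))
    (G := fun f => ∑ s ∈ S,
      MvPowerSeries.pderiv ℂ k (φ (MvPowerSeries.X s)) * φ (MvPowerSeries.pderiv ℂ s f))
    ((continuous_pderiv k).comp hφ) (continuous_finsetSum _ fun s _ =>
      continuous_const.mul (hφ.comp (continuous_pderiv s))) (fun p => ?_) f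
  induction p using MvPolynomial.induction_on with
  | C c =>
    have h1 : φ (MvPowerSeries.C c) = MvPowerSeries.C c := by
      simpa [MvPowerSeries.algebraMap_apply] using φ.commutes c
    simp [h1]
  | add p q hp hq =>
    rw [MvPolynomial.coe_add, map_add, map_add, hp, hq, ← Finset.sum_add_distrib]
    simp [mul_add]
  | mul_X p n hp =>
    have h1 : ∑ s ∈ S, MvPowerSeries.pderiv ℂ k (φ (MvPowerSeries.X s)) *
        φ (MvPowerSeries.pderiv ℂ s (MvPowerSeries.X n)) =
        MvPowerSeries.pderiv ℂ k (φ (MvPowerSeries.X n)) := by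
      by_cases hn : n ∈ S
      · rw [Finset.sum_eq_single_of_mem n hn]
        · simp
        · intro s _ hs
          rw [MvPowerSeries.pderiv_X_of_ne hs.symm, map_zero, mul_zero]
      · rw [hS n hn]
        refine Finset.sum_eq_zero fun s hs => ?_
        rw [MvPowerSeries.pderiv_X_of_ne (by rintro rfl; exact hn hs), map_zero, mul_zero]
    simp only [MvPolynomial.coe_mul, MvPolynomial.coe_X, map_mul, Derivation.leibniz, hp,
      smul_eq_mul, map_add, mul_add, Finset.sum_add_distrib, ← h1]
    rw [Finset.mul_sum, Finset.mul_sum]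
    congr 1 <;> exact Finset.sum_congr rfl fun s _ => by ring

theorem pderiv_comm (i j : σ) (f : MvPowerSeries σ ℂ) :
    MvPowerSeries.pderiv ℂ i (MvPowerSeries.pderiv ℂ j f) =
      MvPowerSeries.pderiv ℂ j (MvPowerSeries.pderiv ℂ i f) := by
  classical
  ext d
  simp only [MvPowerSeries.coeff_pderiv, Finsupp.add_apply]
  rw [add_right_comm]
  by_cases h : i = j
  · subst h; rfl
  · rw [Finsupp.single_eq_of_ne (Ne.symm h), Finsupp.single_eq_of_ne h]
    push_cast; ring

end PowerSeriesCalculus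

/-! ### Specialization homomorphisms -/

section HasSubst

variable {σ τ υ : Type*}

theorem hasSubst_sumElim {a : σ → MvPowerSeries υ ℂ} {b : τ → MvPowerSeries υ ℂ}
    (ha : MvPowerSeries.HasSubst a) (hb : MvPowerSeries.HasSubst b) :
    MvPowerSeries.HasSubst (Sum.elim a b) where
  const_coeff s := by
    cases s with
    | inl s => exact ha.const_coeff s
    | inr s => exact hb.const_coeff s
  coeff_zero d := by
    refine (((ha.coeff_zero d).image Sum.inl).union ((hb.coeff_zero d).image Sum.inr)).subset ?_
    rintro (s | s) hs
    · exact Or.inl ⟨s, hs, rfl⟩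
    · exact Or.inr ⟨s, hs, rfl⟩

theorem hasSubst_optionElim {a : σ → MvPowerSeries υ ℂ} {c : MvPowerSeries υ ℂ}
    (ha : MvPowerSeries.HasSubst a) (hc : MvPowerSeries.constantCoeff c = 0) :
    MvPowerSeries.HasSubst (fun o : Option σ => o.elim c a) where
  const_coeff s := by
    cases s with
    | none => simp [hc]
    | some s => exact ha.const_coeff s
  coeff_zero d := by
    refine (((ha.coeff_zero d).image some).union (Set.finite_singleton none)).subset ?_
    rintro (_ | s) hs
    · exact Or.inr rfl
    · exact Or.inl ⟨s, hs, rfl⟩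

end HasSubst

/-- A function of `t_o`, regarded as a function of `(t_o, t_o')`. -/
noncomputable def leftHom : TimeSeries →ₐ[ℂ] PairSeries :=
  MvPowerSeries.rename (Function.Embedding.inl : ℕ ↪ ℕ ⊕ ℕ)

/-- The function `f(t_o')` of `(t_o, t_o')`. -/
noncomputable def rightHom : TimeSeries →ₐ[ℂ] PairSeries :=
  MvPowerSeries.rename (Function.Embedding.inr : ℕ ↪ ℕ ⊕ ℕ)

/-- The function `f(t_o - t_o')` of `(t_o, t_o')`. -/
noncomputable def diffHom : TimeSeries →ₐ[ℂ] PairSeries :=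
  MvPowerSeries.substAlgHom hasSubst_diff

/-- Restriction to the diagonal `t_o' = t_o`. -/
noncomputable def diagHom : PairSeries →ₐ[ℂ] TimeSeries :=
  MvPowerSeries.substAlgHom
    (hasSubst_sumElim (MvPowerSeries.HasSubst.X (σ := ℕ) (S := ℂ)) MvPowerSeries.HasSubst.X)

/-- Functions of `t_o` are functions of `t_o` and `λ`. -/
noncomputable def inclHom : TimeSeries →ₐ[ℂ] LamSeries :=
  MvPowerSeries.rename (Function.Embedding.some : ℕ ↪ Option ℕ)

/-- The Miwa shift `f(t_o) ↦ f(t_o - 2[λ⁻¹]_o)`. -/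
noncomputable def shiftHom : TimeSeries →ₐ[ℂ] LamSeries :=
  MvPowerSeries.substAlgHom hasSubst_shiftedTime

theorem hasSubst_X_some :
    MvPowerSeries.HasSubst (fun n : ℕ => (MvPowerSeries.X (some n) : LamSeries)) :=
  MvPowerSeries.HasSubst.X_comp (Function.Embedding.some : ℕ ↪ Option ℕ)

/-- The specialization `t_o' = t_o - 2[λ⁻¹]_o`. -/
noncomputable def miwaHom : PairSeries →ₐ[ℂ] LamSeries :=
  MvPowerSeries.substAlgHom (hasSubst_sumElim hasSubst_X_some hasSubst_shiftedTime)

/-- The substitution `(t_o, λ) ↦ (t_o - 2[λ⁻¹]_o, -λ)`. -/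
noncomputable def flipHom : LamSeries →ₐ[ℂ] LamSeries :=
  MvPowerSeries.substAlgHom
    (hasSubst_optionElim (c := -lamInv) hasSubst_shiftedTime (by simp [lamInv]))

theorem incl_eq (f : TimeSeries) : incl f = inclHom f := rfl

theorem shift_eq (f : TimeSeries) : shift f = shiftHom f := by simp [shift, shiftHom]

@[simp] theorem leftHom_X (n : ℕ) :
    leftHom (MvPowerSeries.X n) = MvPowerSeries.X (Sum.inl n) := by simp [leftHom]

@[simp] theorem rightHom_X (n : ℕ) :
    rightHom (MvPowerSeries.X n) = MvPowerSeries.X (Sum.inr n) := by simp [rightHom]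

@[simp] theorem diffHom_X (n : ℕ) : diffHom (MvPowerSeries.X n) =
    MvPowerSeries.X (Sum.inl n) - MvPowerSeries.X (Sum.inr n) := by
  rw [diffHom, MvPowerSeries.substAlgHom_X]

@[simp] theorem diagHom_X_inl (n : ℕ) :
    diagHom (MvPowerSeries.X (Sum.inl n)) = MvPowerSeries.X n := by
  rw [diagHom, MvPowerSeries.substAlgHom_X, Sum.elim_inl]

@[simp] theorem diagHom_X_inr (n : ℕ) :
    diagHom (MvPowerSeries.X (Sum.inr n)) = MvPowerSeries.X n := by
  rw [diagHom, MvPowerSeries.substAlgHom_X, Sum.elim_inr]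

@[simp] theorem inclHom_X (n : ℕ) :
    inclHom (MvPowerSeries.X n) = MvPowerSeries.X (some n) := by simp [inclHom]

@[simp] theorem shiftHom_X (n : ℕ) : shiftHom (MvPowerSeries.X n) = shiftedTime n := by
  rw [shiftHom, MvPowerSeries.substAlgHom_X]

@[simp] theorem miwaHom_X_inl (n : ℕ) :
    miwaHom (MvPowerSeries.X (Sum.inl n)) = MvPowerSeries.X (some n) := by
  rw [miwaHom, MvPowerSeries.substAlgHom_X, Sum.elim_inl]

@[simp] theorem miwaHom_X_inr (n : ℕ) :
    miwaHom (MvPowerSeries.X (Sum.inr n)) = shiftedTime n := by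
  rw [miwaHom, MvPowerSeries.substAlgHom_X, Sum.elim_inr]

@[simp] theorem flipHom_X_some (n : ℕ) :
    flipHom (MvPowerSeries.X (some n)) = shiftedTime n := by
  rw [flipHom, MvPowerSeries.substAlgHom_X, Option.elim_some]

@[simp] theorem flipHom_lamInv : flipHom lamInv = -lamInv := by
  rw [lamInv, flipHom, MvPowerSeries.substAlgHom_X, Option.elim_none, lamInv]

@[simp] theorem flipHom_shiftedTime (n : ℕ) :
    flipHom (shiftedTime n) = MvPowerSeries.X (some n) := by
  have h : (-lamInv) ^ (2 * n + 1) = -lamInv ^ (2 * n + 1) := Odd.neg_pow ⟨n, rfl⟩ _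
  rw [shiftedTime, map_sub, map_smul, map_pow, flipHom_lamInv, flipHom_X_some, h, shiftedTime]
  simp

theorem continuous_leftHom : Continuous leftHom := continuous_rename _
theorem continuous_rightHom : Continuous rightHom := continuous_rename _
theorem continuous_diffHom : Continuous diffHom := continuous_substAlgHom _
theorem continuous_diagHom : Continuous diagHom := continuous_substAlgHom _
theorem continuous_inclHom : Continuous inclHom := continuous_rename _
theorem continuous_shiftHom : Continuous shiftHom := continuous_substAlgHom _
theorem continuous_miwaHom : Continuous miwaHom := continuous_substAlgHom _
theorem continuous_flipHom : Continuous flipHom := continuous_substAlgHom _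

@[simp] theorem diagHom_leftHom (f : TimeSeries) : diagHom (leftHom f) = f :=
  algHom_eq_of_eq_X (φ := diagHom.comp leftHom) (ψ := AlgHom.id ℂ _)
    (continuous_diagHom.comp continuous_leftHom) continuous_id (by simp) f

@[simp] theorem diagHom_rightHom (f : TimeSeries) : diagHom (rightHom f) = f :=
  algHom_eq_of_eq_X (φ := diagHom.comp rightHom) (ψ := AlgHom.id ℂ _)
    (continuous_diagHom.comp continuous_rightHom) continuous_id (by simp) f

@[simp] theorem miwaHom_leftHom (f : TimeSeries) : miwaHom (leftHom f) = inclHom f :=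
  algHom_eq_of_eq_X (φ := miwaHom.comp leftHom) (ψ := inclHom)
    (continuous_miwaHom.comp continuous_leftHom) continuous_inclHom (by simp) f

@[simp] theorem miwaHom_rightHom (f : TimeSeries) : miwaHom (rightHom f) = shiftHom f :=
  algHom_eq_of_eq_X (φ := miwaHom.comp rightHom) (ψ := shiftHom)
    (continuous_miwaHom.comp continuous_rightHom) continuous_shiftHom (by simp) f

@[simp] theorem flipHom_inclHom (f : TimeSeries) : flipHom (inclHom f) = shiftHom f :=
  algHom_eq_of_eq_X (φ := flipHom.comp inclHom) (ψ := shiftHom)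
    (continuous_flipHom.comp continuous_inclHom) continuous_shiftHom (by simp) f

@[simp] theorem flipHom_shiftHom (f : TimeSeries) : flipHom (shiftHom f) = inclHom f :=
  algHom_eq_of_eq_X (φ := flipHom.comp shiftHom) (ψ := inclHom)
    (continuous_flipHom.comp continuous_shiftHom) continuous_inclHom (by simp) f

@[simp] theorem flipHom_flipHom (f : LamSeries) : flipHom (flipHom f) = f := by
  refine algHom_eq_of_eq_X (φ := flipHom.comp flipHom) (ψ := AlgHom.id ℂ _)
    (continuous_flipHom.comp continuous_flipHom) continuous_id (fun s => ?_) f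
  cases s with
  | none =>
    change flipHom (flipHom lamInv) = lamInv
    simp
  | some n => simp

theorem constantCoeff_algHom {σ τ : Type*} {φ : MvPowerSeries σ ℂ →ₐ[ℂ] MvPowerSeries τ ℂ}
    (hφ : Continuous φ) (h : ∀ s, MvPowerSeries.constantCoeff (φ (MvPowerSeries.X s)) = 0)
    (f : MvPowerSeries σ ℂ) :
    MvPowerSeries.constantCoeff (φ f) = MvPowerSeries.constantCoeff f := by
  refine eq_of_eq_on_polynomials (F := fun f => MvPowerSeries.constantCoeff (φ f))
    ((MvPowerSeries.WithPiTopology.continuous_constantCoeff ℂ).comp hφ)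
    (MvPowerSeries.WithPiTopology.continuous_constantCoeff ℂ) (fun p => ?_) f
  induction p using MvPolynomial.induction_on with
  | C c =>
    have h1 : φ (MvPowerSeries.C c) = MvPowerSeries.C c := by
      simpa [MvPowerSeries.algebraMap_apply] using φ.commutes c
    simp [h1]
  | add p q hp hq => simp [hp, hq]
  | mul_X p n hp => simp [h n]

@[simp] theorem constantCoeff_inclHom (f : TimeSeries) :
    MvPowerSeries.constantCoeff (inclHom f) = MvPowerSeries.constantCoeff f :=
  constantCoeff_algHom continuous_inclHom (by simp) f

@[simp] theorem constantCoeff_shiftHom (f : TimeSeries) :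
    MvPowerSeries.constantCoeff (shiftHom f) = MvPowerSeries.constantCoeff f :=
  constantCoeff_algHom continuous_shiftHom (by simp [shiftedTime, lamInv]) f

@[simp] theorem constantCoeff_flipHom (f : LamSeries) :
    MvPowerSeries.constantCoeff (flipHom f) = MvPowerSeries.constantCoeff f := by
  refine constantCoeff_algHom continuous_flipHom (fun s => ?_) f
  cases s with
  | none =>
    change MvPowerSeries.constantCoeff (flipHom lamInv) = 0
    rw [flipHom_lamInv]
    simp [lamInv]
  | some n => simp [shiftedTime, lamInv]

/-! ### Derivatives of specializations -/

theorem pderiv_lamInv (n : ℕ) : MvPowerSeries.pderiv ℂ (some n) lamInv = 0 :=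
  MvPowerSeries.pderiv_X_of_ne (by simp)

theorem pderiv_shiftedTime (k n : ℕ) : MvPowerSeries.pderiv ℂ (some k) (shiftedTime n) =
    MvPowerSeries.pderiv ℂ (some k) (MvPowerSeries.X (some n)) := by
  rw [shiftedTime, map_sub, Derivation.map_smul, Derivation.leibniz_pow, pderiv_lamInv]
  simp

theorem pderiv_shiftHom (k : ℕ) (f : TimeSeries) :
    MvPowerSeries.pderiv ℂ (some k) (shiftHom f) = shiftHom (dt k f) := by
  rw [pderiv_algHom continuous_shiftHom (some k) {k}]
  · simp [pderiv_shiftedTime]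
  · intro s hs
    rw [shiftHom_X, pderiv_shiftedTime, MvPowerSeries.pderiv_X_of_ne (by simpa using hs)]

theorem pderiv_inclHom (k : ℕ) (f : TimeSeries) :
    MvPowerSeries.pderiv ℂ (some k) (inclHom f) = inclHom (dt k f) := by
  rw [pderiv_algHom continuous_inclHom (some k) {k}]
  · simp
  · intro s hs
    rw [inclHom_X, MvPowerSeries.pderiv_X_of_ne (by simpa using hs)]

theorem pderiv_flipHom (k : ℕ) (f : LamSeries) :
    MvPowerSeries.pderiv ℂ (some k) (flipHom f) =
      flipHom (MvPowerSeries.pderiv ℂ (some k) f) := by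
  rw [pderiv_algHom continuous_flipHom (some k) {some k}]
  · simp [pderiv_shiftedTime]
  · rintro (_ | s) hs
    · change MvPowerSeries.pderiv ℂ (some k) (flipHom lamInv) = 0
      rw [flipHom_lamInv, map_neg, pderiv_lamInv, neg_zero]
    · rw [flipHom_X_some, pderiv_shiftedTime, MvPowerSeries.pderiv_X_of_ne (by simpa using hs)]

theorem pderiv_inl_leftHom (k : ℕ) (f : TimeSeries) :
    MvPowerSeries.pderiv ℂ (Sum.inl k) (leftHom f) = leftHom (dt k f) := by
  rw [pderiv_algHom continuous_leftHom (Sum.inl k) {k}]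
  · simp
  · intro s hs
    rw [leftHom_X, MvPowerSeries.pderiv_X_of_ne (by simpa using hs)]

theorem pderiv_inr_rightHom (k : ℕ) (f : TimeSeries) :
    MvPowerSeries.pderiv ℂ (Sum.inr k) (rightHom f) = rightHom (dt k f) := by
  rw [pderiv_algHom continuous_rightHom (Sum.inr k) {k}]
  · simp
  · intro s hs
    rw [rightHom_X, MvPowerSeries.pderiv_X_of_ne (by simpa using hs)]

theorem pderiv_inr_leftHom (k : ℕ) (f : TimeSeries) :
    MvPowerSeries.pderiv ℂ (Sum.inr k) (leftHom f) = 0 := by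
  rw [pderiv_algHom continuous_leftHom (Sum.inr k) ∅ (by simp [MvPowerSeries.pderiv_X_of_ne])]
  simp

theorem pderiv_inl_rightHom (k : ℕ) (f : TimeSeries) :
    MvPowerSeries.pderiv ℂ (Sum.inl k) (rightHom f) = 0 := by
  rw [pderiv_algHom continuous_rightHom (Sum.inl k) ∅ (by simp [MvPowerSeries.pderiv_X_of_ne])]
  simp

theorem pderiv_inl_diffHom (k : ℕ) (f : TimeSeries) :
    MvPowerSeries.pderiv ℂ (Sum.inl k) (diffHom f) = diffHom (dt k f) := by
  rw [pderiv_algHom continuous_diffHom (Sum.inl k) {k}]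
  · simp [MvPowerSeries.pderiv_X_of_ne]
  · intro s hs
    rw [diffHom_X, map_sub, MvPowerSeries.pderiv_X_of_ne (by simpa using hs),
      MvPowerSeries.pderiv_X_of_ne (by simp), sub_zero]

theorem pderiv_inr_diffHom (k : ℕ) (f : TimeSeries) :
    MvPowerSeries.pderiv ℂ (Sum.inr k) (diffHom f) = -diffHom (dt k f) := by
  rw [pderiv_algHom continuous_diffHom (Sum.inr k) {k}]
  · simp [MvPowerSeries.pderiv_X_of_ne]
  · intro s hs
    rw [diffHom_X, map_sub, MvPowerSeries.pderiv_X_of_ne (j := Sum.inr s) (by simpa using hs),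
      MvPowerSeries.pderiv_X_of_ne (by simp), sub_zero]

theorem dt_diagHom (k : ℕ) (F : PairSeries) : dt k (diagHom F) =
    diagHom (MvPowerSeries.pderiv ℂ (Sum.inl k) F) +
      diagHom (MvPowerSeries.pderiv ℂ (Sum.inr k) F) := by
  rw [pderiv_algHom continuous_diagHom k {Sum.inl k, Sum.inr k}]
  · rw [Finset.sum_pair (by simp)]
    simp
  · rintro (s | s) hs
    · rw [diagHom_X_inl, MvPowerSeries.pderiv_X_of_ne (by simp at hs; exact hs)]
    · rw [diagHom_X_inr, MvPowerSeries.pderiv_X_of_ne (by simp at hs; exact hs)]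

/-- If all members of a set of series closed under partial derivatives have constant term zero,
then they vanish. -/
theorem eq_zero_of_pderiv_mem {σ : Type*} {S : Set (MvPowerSeries σ ℂ)}
    (h0 : ∀ F ∈ S, MvPowerSeries.constantCoeff F = 0)
    (h1 : ∀ F ∈ S, ∀ i, MvPowerSeries.pderiv ℂ i F ∈ S) {F : MvPowerSeries σ ℂ} (hF : F ∈ S) :
    F = 0 := by
  classical
  ext d
  induction hn : d.degree generalizing d F with
  | zero =>
    rw [Finsupp.degree_eq_zero_iff] at hn
    subst hn
    simpa using h0 F hF
  | succ n ih =>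
    obtain ⟨i, hi⟩ : ∃ i, d i ≠ 0 := by
      by_contra! h
      rw [show d = 0 from Finsupp.ext h] at hn
      simp at hn
    have hd : d - Finsupp.single i 1 + Finsupp.single i 1 = d :=
      tsub_add_cancel_of_le (Finsupp.single_le_iff.mpr (Nat.one_le_iff_ne_zero.mpr hi))
    have h2 := ih (h1 F hF i) (d - Finsupp.single i 1) (by
      rw [← hd, map_add, Finsupp.degree_single] at hn
      omega)
    rw [MvPowerSeries.coeff_pderiv, hd] at h2
    rcases mul_eq_zero.mp h2 with h | h
    · exact h
    · exact absurd h (Nat.cast_add_one_ne_zero _)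

theorem constantCoeff_diagHom (F : PairSeries) :
    MvPowerSeries.constantCoeff (diagHom F) = MvPowerSeries.constantCoeff F :=
  constantCoeff_algHom continuous_diagHom (by rintro (s | s) <;> simp) F

/-- A series in `(t_o, t_o')` that does not depend on `t_o'` and vanishes on the diagonal is
zero: by the chain rule both properties pass to its derivatives along `t_o`. -/
theorem eq_zero_of_pderiv_inr {F : PairSeries}
    (hF : ∀ k, MvPowerSeries.pderiv ℂ (Sum.inr k) F = 0) (hd : diagHom F = 0) : F = 0 := by
  refine eq_zero_of_pderiv_mem
    (S := {F | (∀ k, MvPowerSeries.pderiv ℂ (Sum.inr k) F = 0) ∧ diagHom F = 0})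
    ?_ ?_ ⟨hF, hd⟩
  · rintro F ⟨_, h2⟩
    rw [← constantCoeff_diagHom, h2, map_zero]
  · rintro F ⟨h1, h2⟩ (k | k)
    · refine ⟨fun l => by rw [pderiv_comm, h1, map_zero], ?_⟩
      have := dt_diagHom k F
      rwa [h1, h2, map_zero, map_zero, add_zero, eq_comm] at this
    · rw [h1]
      exact ⟨fun l => map_zero _, map_zero _⟩

/-- A series in `(t_o, t_o')` that does not depend on `t_o` and vanishes on the diagonal is
zero. -/
theorem eq_zero_of_pderiv_inl {F : PairSeries}
    (hF : ∀ k, MvPowerSeries.pderiv ℂ (Sum.inl k) F = 0) (hd : diagHom F = 0) : F = 0 := by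
  refine eq_zero_of_pderiv_mem
    (S := {F | (∀ k, MvPowerSeries.pderiv ℂ (Sum.inl k) F = 0) ∧ diagHom F = 0})
    ?_ ?_ ⟨hF, hd⟩
  · rintro F ⟨_, h2⟩
    rw [← constantCoeff_diagHom, h2, map_zero]
  · rintro F ⟨h1, h2⟩ (k | k)
    · rw [h1]
      exact ⟨fun l => map_zero _, map_zero _⟩
    · refine ⟨fun l => by rw [pderiv_comm, h1, map_zero], ?_⟩
      have := dt_diagHom k F
      rwa [h1, h2, map_zero, map_zero, zero_add, eq_comm] at this

/-! ### The coefficients of the exponential factor -/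

theorem coeff_expCoeff (n : ℕ) (d : ℕ →₀ ℕ) : MvPowerSeries.coeff d (expCoeff n) =
    if (d.sum fun k e => (2 * k + 1) * e) = n then d.prod fun _ e => ((e.factorial : ℂ))⁻¹
    else 0 := rfl

theorem dt_expCoeff (k n : ℕ) : dt k (expCoeff n) =
    if 2 * k + 1 ≤ n then expCoeff (n - (2 * k + 1)) else 0 := by
  classical
  ext d
  have hs : ((d + Finsupp.single k 1).sum fun k e => (2 * k + 1) * e) =
      (d.sum fun k e => (2 * k + 1) * e) + (2 * k + 1) := by
    rw [Finsupp.sum_add_index' (by simp) (by intros; ring), Finsupp.sum_single_index (by simp),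
      mul_one]
  have hp : ((d + Finsupp.single k 1).prod fun _ e => ((e.factorial : ℂ))⁻¹) * (d k + 1) =
      d.prod fun _ e => ((e.factorial : ℂ))⁻¹ := by
    have h1 : ((d + Finsupp.single k 1).prod fun _ e => ((e.factorial : ℂ))⁻¹) =
        ∏ i ∈ insert k d.support, ((((d + Finsupp.single k 1 : ℕ →₀ ℕ) i).factorial : ℂ))⁻¹ := by
      refine Finsupp.prod_of_support_subset _ ?_ _ (by simp)
      refine Finsupp.support_add.trans ?_
      refine Finset.union_subset (Finset.subset_insert _ _) ?_
      exact Finsupp.support_single_subset.trans (Finset.singleton_subset_iff.mpr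
        (Finset.mem_insert_self _ _))
    have h2 : (d.prod fun _ e => ((e.factorial : ℂ))⁻¹) =
        ∏ i ∈ insert k d.support, (((d i).factorial : ℂ))⁻¹ :=
      Finsupp.prod_of_support_subset _ (Finset.subset_insert _ _) _ (by simp)
    rw [h1, h2, ← Finset.mul_prod_erase _ _ (Finset.mem_insert_self k _),
      ← Finset.mul_prod_erase _ _ (Finset.mem_insert_self k _), mul_right_comm]
    congr 1
    · have : ((d k : ℂ) + 1) ≠ 0 := Nat.cast_add_one_ne_zero _
      have h3 : ((d k).factorial : ℂ) ≠ 0 := by exact_mod_cast Nat.factorial_ne_zero _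
      rw [Finsupp.add_apply, Finsupp.single_eq_same, Nat.factorial_succ]
      push_cast
      field_simp
    · refine Finset.prod_congr rfl fun i hi => ?_
      rw [Finsupp.add_apply, Finsupp.single_eq_of_ne (Finset.ne_of_mem_erase hi), add_zero]
  rw [MvPowerSeries.coeff_pderiv, coeff_expCoeff, hs]
  by_cases hn : 2 * k + 1 ≤ n
  · rw [if_pos hn, coeff_expCoeff, ite_mul, zero_mul, hp]
    congr 1
    exact propext ⟨fun h => by omega, fun h => by omega⟩
  · rw [if_neg hn, if_neg (by omega), zero_mul, map_zero]

theorem expCoeff_zero : expCoeff 0 = 1 := by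
  classical
  ext d
  rw [coeff_expCoeff, MvPowerSeries.coeff_one]
  by_cases hd : d = 0
  · simp [hd]
  · rw [if_neg hd, if_neg]
    intro h
    rw [Finsupp.sum, Finset.sum_eq_zero_iff] at h
    obtain ⟨i, hi⟩ := Finsupp.support_nonempty_iff.mpr hd
    have := h i hi
    simp only [mul_eq_zero] at this
    exact this.elim (by omega) (Finsupp.mem_support_iff.mp hi)

theorem constantCoeff_expCoeff {n : ℕ} (hn : n ≠ 0) :
    MvPowerSeries.constantCoeff (expCoeff n) = 0 := by
  rw [← MvPowerSeries.coeff_zero_eq_constantCoeff_apply, coeff_expCoeff, if_neg]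
  simpa using hn.symm

/-- Euler's identity for the weighted homogeneous series `h_n`. -/
theorem natCast_mul_expCoeff (n : ℕ) : (n : ℂ) • expCoeff n =
    ∑ k ∈ Finset.range n, ((2 * k + 1 : ℕ) : ℂ) • (MvPowerSeries.X k * dt k (expCoeff n)) := by
  classical
  have hX : ∀ (k : ℕ) (f : TimeSeries) (d : ℕ →₀ ℕ),
      MvPowerSeries.coeff d (MvPowerSeries.X k * dt k f) = d k * MvPowerSeries.coeff d f := by
    intro k f d
    rw [MvPowerSeries.X, MvPowerSeries.coeff_monomial_mul]
    by_cases hk : d k = 0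
    · rw [if_neg (by simp [Finsupp.single_le_iff, hk]), hk, Nat.cast_zero, zero_mul]
    · have h1 : Finsupp.single k 1 ≤ d :=
        Finsupp.single_le_iff.mpr (Nat.one_le_iff_ne_zero.mpr hk)
      rw [if_pos h1, MvPowerSeries.coeff_pderiv, tsub_add_cancel_of_le h1, Finsupp.tsub_apply,
        Finsupp.single_eq_same, Nat.cast_sub (Nat.one_le_iff_ne_zero.mpr hk)]
      push_cast
      ring
  ext d
  rw [map_sum, MvPowerSeries.coeff_smul]
  simp only [MvPowerSeries.coeff_smul, hX, ← mul_assoc]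
  rw [← Finset.sum_mul, coeff_expCoeff]
  split_ifs with h
  · congr 1
    have hsub : d.support ⊆ Finset.range n := by
      intro k hk
      have h1 : (2 * k + 1) * d k ≤ n := by
        rw [← h]
        exact Finset.single_le_sum (f := fun k => (2 * k + 1) * d k) (fun _ _ => Nat.zero_le _) hk
      have h2 : 1 ≤ d k := Nat.one_le_iff_ne_zero.mpr (Finsupp.mem_support_iff.mp hk)
      rw [Finset.mem_range]
      nlinarith
    have h3 : (n : ℂ) = ((∑ k ∈ Finset.range n, (2 * k + 1) * d k : ℕ) : ℂ) := by
      rw [← Finsupp.sum_of_support_subset d hsub (fun k e => (2 * k + 1) * e) (by simp), h]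
    rw [h3]
    push_cast
    rfl
  · simp

/-- The coefficients of `(1 + y) / (1 - y) = 1 + 2 y + 2 y² + ⋯`. -/
def cayleyCoeff (n : ℕ) : ℂ := if n = 0 then 1 else 2

theorem sum_cayleyCoeff (n : ℕ) : (∑ k ∈ Finset.range n,
    if 2 * k + 1 ≤ n then 2 * cayleyCoeff (n - (2 * k + 1)) else 0) = n * cayleyCoeff n := by
  have key : ∀ n, (∑ k ∈ Finset.range (n + 1),
      if 2 * k + 1 ≤ n then 2 * cayleyCoeff (n - (2 * k + 1)) else 0) = 2 * n := by
    intro n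
    induction n using Nat.twoStepInduction with
    | zero => simp
    | one => simp [cayleyCoeff]
    | more n ih _ =>
      have hlast : (if 2 * 0 + 1 ≤ n + 2 then 2 * cayleyCoeff (n + 2 - (2 * 0 + 1)) else 0) =
          4 := by
        rw [if_pos (by omega), cayleyCoeff, if_neg (by omega)]
        norm_num
      rw [Finset.sum_range_succ, Finset.sum_range_succ', hlast,
        if_neg (show ¬ 2 * (n + 2) + 1 ≤ n + 2 by omega)]
      have : ∀ k ∈ Finset.range (n + 1), (if 2 * (k + 1) + 1 ≤ n + 2 then
          2 * cayleyCoeff (n + 2 - (2 * (k + 1) + 1)) else 0) =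
          if 2 * k + 1 ≤ n then 2 * cayleyCoeff (n - (2 * k + 1)) else 0 := by
        intro k _
        congr 1
        · exact propext ⟨fun h => by omega, fun h => by omega⟩
        · rw [show n + 2 - (2 * (k + 1) + 1) = n - (2 * k + 1) by omega]
      rw [Finset.sum_congr rfl this, ih]
      push_cast
      ring
  have h := key n
  rcases Nat.eq_zero_or_pos n with rfl | hn
  · simp
  · rw [Finset.sum_range_succ, if_neg (by omega), add_zero] at h
    rw [h, cayleyCoeff, if_neg hn.ne', mul_comm]

/-- `e^{ξ(2[μ⁻¹]_o, λ)} = (1 + λ/μ) / (1 - λ/μ)`. -/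
theorem miwaHom_expCoeffDiff (n : ℕ) :
    miwaHom (expCoeffDiff n) = cayleyCoeff n • lamInv ^ n := by
  have hdiff : ∀ n, expCoeffDiff n = diffHom (expCoeff n) := fun n => by
    simp [expCoeffDiff, diffHom]
  have hX : ∀ k, miwaHom (diffHom (MvPowerSeries.X k)) =
      ((2 : ℂ) / (2 * k + 1)) • lamInv ^ (2 * k + 1) := fun k => by
    simp [shiftedTime]
  rw [hdiff]
  induction n using Nat.strong_induction_on with
  | _ n ih =>
    rcases Nat.eq_zero_or_pos n with rfl | hn
    · simp [expCoeff_zero, cayleyCoeff]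
    · have h := congrArg (fun f => miwaHom (diffHom f)) (natCast_mul_expCoeff n)
      simp only [map_smul, map_sum, map_mul, hX, dt_expCoeff] at h
      have h2 : ∀ k ∈ Finset.range n, ((2 * k + 1 : ℕ) : ℂ) •
          (((2 : ℂ) / (2 * k + 1)) • lamInv ^ (2 * k + 1) *
            miwaHom (diffHom (if 2 * k + 1 ≤ n then expCoeff (n - (2 * k + 1)) else 0))) =
          (if 2 * k + 1 ≤ n then 2 * cayleyCoeff (n - (2 * k + 1)) else 0) • lamInv ^ n := by
        intro k _
        split_ifs with hk
        · have hne : (2 * k + 1 : ℂ) ≠ 0 := by exact_mod_cast (2 * k).succ_ne_zero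
          rw [ih _ (by omega), smul_mul_smul_comm, smul_smul, ← pow_add,
            show 2 * k + 1 + (n - (2 * k + 1)) = n by omega]
          congr 1
          push_cast
          field_simp
        · simp
      rw [Finset.sum_congr rfl h2, ← Finset.sum_smul, sum_cayleyCoeff, mul_smul] at h
      exact smul_right_injective _ (Nat.cast_ne_zero.mpr hn.ne') h

/-! ### Pseudo-differential operators -/

namespace PsDO

variable {A : Type*} [CommRing A] [Algebra ℂ A] {D : Derivation ℂ A A}

@[simp] theorem coeff_sub (P Q : PsDO D) (i : ℤ) : (P - Q).coeff i = P.coeff i - Q.coeff i := by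
  rw [sub_eq_add_neg, coeff_add, coeff_neg, sub_eq_add_neg]

theorem coeff_ofFun (a : A) (i : ℤ) : (ofFun a : PsDO D).coeff i = if i = 0 then a else 0 := rfl

theorem coeff_del (i j : ℤ) : (del i : PsDO D).coeff j = if j = i then 1 else 0 := rfl

theorem coeff_nonneg (P : PsDO D) (i : ℤ) :
    P.nonneg.coeff i = if 0 ≤ i then P.coeff i else 0 := rfl

theorem coeff_sum {ι : Type*} (s : Finset ι) (f : ι → PsDO D) (j : ℤ) :
    (∑ k ∈ s, f k).coeff j = ∑ k ∈ s, (f k).coeff j := by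
  classical
  induction s using Finset.induction_on with
  | empty => simp
  | insert a s ha ih => rw [Finset.sum_insert ha, Finset.sum_insert ha, coeff_add, ih]

@[simp] theorem coeff_ofFun_mul (a : A) (P : PsDO D) (i : ℤ) :
    (ofFun a * P).coeff i = a * P.coeff i := by
  rw [coeff_mul, finsum_eq_single _ ((0 : ℤ), 0)]
  · simp [ofFun, coeff_monomial]
  · rintro ⟨j, k⟩ h
    by_cases hj : j = 0
    · subst hj
      have hk : 0 < k := Nat.pos_of_ne_zero fun h' => h (by rw [h'])
      simp [Ring.choose_zero_pos ℤ hk]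
    · simp [ofFun, coeff_monomial, hj]

@[simp] theorem coeff_mul_del (P : PsDO D) (c i : ℤ) :
    (P * del c).coeff i = P.coeff (i - c) := by
  rw [coeff_mul, finsum_eq_single _ (i - c, 0)]
  · simp [del, coeff_monomial]
  · rintro ⟨j, k⟩ h
    by_cases hj : i - j + k = c
    · have hk : k ≠ 0 := by
        rintro rfl
        exact h (by ext <;> simp; omega)
      simp [del, coeff_monomial, hj, iterate_one k hk]
    · simp [del, coeff_monomial, hj, iterate_map_zero]

@[simp] theorem coeff_del_one_mul (P : PsDO D) (i : ℤ) :
    (del 1 * P).coeff i = P.coeff (i - 1) + D (P.coeff i) := by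
  classical
  rw [coeff_mul, finsum_eq_sum_of_support_subset (s := {((1 : ℤ), 0), ((1 : ℤ), 1)})]
  · rw [Finset.sum_pair (by simp)]
    simp [del, coeff_monomial]
  · rintro ⟨j, k⟩ h
    by_cases hj : j = 1
    · subst hj
      by_cases hk : 1 < k
      · refine absurd ?_ h
        have h1 : Ring.choose (1 : ℤ) k = 0 := by
          have := Ring.choose_natCast (R := ℤ) 1 k
          rw [Nat.cast_one, Nat.choose_eq_zero_of_lt hk] at this
          simpa using this
        simp [h1]
      · have : k = 0 ∨ k = 1 := by omega
        rcases this with rfl | rfl <;> simp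
    · exact absurd (by simp [del, coeff_monomial, hj]) h

theorem del_mul_del (i j : ℤ) : (del i * del j : PsDO D) = del (i + j) := by
  ext k
  rw [coeff_mul_del, coeff_del, coeff_del]
  congr 1
  exact propext ⟨fun h => by omega, fun h => by omega⟩

theorem del_zero : (del 0 : PsDO D) = 1 := rfl

theorem del_one_pow (n : ℕ) : (del 1 : PsDO D) ^ n = del n := by
  induction n with
  | zero => rfl
  | succ n ih => rw [pow_succ, ih, del_mul_del]; simp

/-- `P` has order at most `N`. -/
def OrderLE (P : PsDO D) (N : ℤ) : Prop := ∀ i, N < i → P.coeff i = 0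

theorem OrderLE.mono {P : PsDO D} {N M : ℤ} (h : P.OrderLE N) (hNM : N ≤ M) : P.OrderLE M :=
  fun i hi => h i (by omega)

theorem OrderLE.mul {P Q : PsDO D} {N M : ℤ} (hP : P.OrderLE N) (hQ : Q.OrderLE M) :
    (P * Q).OrderLE (N + M) := mul_bdd hP hQ

theorem OrderLE.add {P Q : PsDO D} {N : ℤ} (hP : P.OrderLE N) (hQ : Q.OrderLE N) :
    (P + Q).OrderLE N := fun i hi => by simp [hP i hi, hQ i hi]

theorem OrderLE.sub {P Q : PsDO D} {N : ℤ} (hP : P.OrderLE N) (hQ : Q.OrderLE N) :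
    (P - Q).OrderLE N := fun i hi => by simp [hP i hi, hQ i hi]

theorem orderLE_monomial (i : ℤ) (a : A) : (monomial i a : PsDO D).OrderLE i :=
  fun j hj => by rw [coeff_monomial, if_neg (by omega)]

theorem orderLE_ofFun (a : A) : (ofFun a : PsDO D).OrderLE 0 := orderLE_monomial 0 a

theorem orderLE_del (i : ℤ) : (del i : PsDO D).OrderLE i := orderLE_monomial i 1

theorem orderLE_sub_nonneg (P : PsDO D) : (P - P.nonneg).OrderLE (-1) := fun i hi => by
  rw [coeff_sub, coeff_nonneg, if_pos (by omega), sub_self]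

theorem OrderLE.pow {P : PsDO D} {N : ℤ} (hP : P.OrderLE N) (k : ℕ) :
    (P ^ k).OrderLE (k * N) := by
  induction k with
  | zero => simpa using! orderLE_monomial (D := D) 0 1
  | succ k ih =>
    rw [pow_succ]
    exact (ih.mul hP).mono (by push_cast; linarith)

theorem coeff_mul_top {P Q : PsDO D} {N M : ℤ} (hP : P.OrderLE N) (hQ : Q.OrderLE M) :
    (P * Q).coeff (N + M) = P.coeff N * Q.coeff M := by
  have := coeff_mul_eq P Q hP hQ 0
  simpa using this

theorem eq_of_forall_orderLE {P Q : PsDO D} (h : ∀ m : ℕ, (P - Q).OrderLE (-m)) : P = Q := by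
  ext i
  have := h ((-i).toNat + 1) i (by push_cast; omega)
  rwa [coeff_sub, sub_eq_zero] at this

/-- An operator `1 + a₁ ∂⁻¹ + a₂ ∂⁻² + ⋯` is invertible; its inverse is a geometric series. -/
theorem isUnit_of_monic {P : PsDO D} (hP : P.OrderLE 0) (h0 : P.coeff 0 = 1) : IsUnit P := by
  obtain ⟨N, rfl⟩ : ∃ N : PsDO D, P = 1 - N := ⟨1 - P, by abel⟩
  have hN : N.OrderLE (-1) := by
    intro i hi
    rcases eq_or_ne i 0 with rfl | hi0
    · simpa [coeff_one] using h0
    · simpa [coeff_one, hi0] using hP i (by omega)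
  have hpow : ∀ k : ℕ, (N ^ k).OrderLE (-k) := fun k => by simpa using hN.pow k
  let V : PsDO D := ⟨fun i => ∑ k ∈ Finset.range ((-i).toNat + 1), (N ^ k).coeff i, 0,
    fun i hi => Finset.sum_eq_zero fun k _ => hpow k i (by omega)⟩
  have hV : ∀ m : ℕ, (V - ∑ k ∈ Finset.range m, N ^ k).OrderLE (-m) := by
    intro m i hi
    rw [coeff_sub, coeff_sum, sub_eq_zero]
    change ∑ k ∈ Finset.range ((-i).toNat + 1), (N ^ k).coeff i = _
    by_cases hi0 : 0 < i
    · rw [Finset.sum_eq_zero fun k _ => hpow k i (by omega)]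
      exact (Finset.sum_eq_zero fun k _ => hpow k i (by omega)).symm
    · refine Finset.sum_subset ?_ fun k _ hk => hpow k i ?_
      · intro k hk
        rw [Finset.mem_range] at hk ⊢
        omega
      · rw [Finset.mem_range] at hk
        omega
  have h1 : (1 - N) * V = 1 := by
    refine eq_of_forall_orderLE fun m => ?_
    have := mul_neg_geom_sum N m
    rw [show (1 - N) * V - 1 = (1 - N) * (V - ∑ k ∈ Finset.range m, N ^ k) - N ^ m by
      rw [mul_sub, this]; abel]
    exact (((hP.mul (hV m)).mono (by omega)).sub (hpow m))
  have h2 : V * (1 - N) = 1 := by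
    refine eq_of_forall_orderLE fun m => ?_
    have := geom_sum_mul_neg N m
    rw [show V * (1 - N) - 1 = (V - ∑ k ∈ Finset.range m, N ^ k) * (1 - N) - N ^ m by
      rw [sub_mul, this]; abel]
    exact ((((hV m).mul hP).mono (by omega)).sub (hpow m))
  exact ⟨⟨_, V, h1, h2⟩, rfl⟩

theorem nonneg_eq_sum (P : PsDO D) {N : ℕ} (hN : P.OrderLE N) :
    P.nonneg = ∑ i ∈ Finset.range (N + 1), ofFun (P.coeff i) * del 1 ^ i := by
  ext j
  rw [coeff_sum]
  simp only [del_one_pow, coeff_ofFun_mul, coeff_del, mul_ite, mul_one, mul_zero]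
  by_cases hj : 0 ≤ j
  · rw [coeff_nonneg, if_pos hj]
    lift j to ℕ using hj
    by_cases hjN : j ≤ N
    · rw [Finset.sum_eq_single_of_mem j (by simp; omega)]
      · simp
      · intro i _ hi
        rw [if_neg (by simpa using hi.symm)]
    · rw [hN _ (by exact_mod_cast not_le.mp hjN), Finset.sum_eq_zero]
      intro i hi
      rw [Finset.mem_range] at hi
      rw [if_neg (by omega)]
  · rw [coeff_nonneg, if_neg hj, Finset.sum_eq_zero]
    intro i _
    rw [if_neg (by omega)]

theorem exists_natCast_orderLE (P : PsDO D) : ∃ N : ℕ, P.OrderLE N := by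
  obtain ⟨N, hN⟩ := P.bdd
  exact ⟨N.toNat, fun i hi => hN i (by omega)⟩

theorem nonneg_apply_eq_sum (P : PsDO D) {N : ℕ} (hN : P.OrderLE N) (f : A) :
    P.nonneg.apply f = ∑ i ∈ Finset.range (N + 1), P.coeff i * (D^[i]) f := by
  have h : ∀ i : ℕ, P.nonneg.coeff i = P.coeff i := fun i => by
    rw [coeff_nonneg, if_pos (by omega)]
  simp only [apply, h]
  refine finsum_eq_sum_of_support_subset _ fun i hi => ?_
  by_contra h
  simp only [Finset.coe_range, Set.mem_Iio, not_lt] at h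
  exact hi (by simp [hN i (by omega)])

/-- If `∂ X` is a differential operator, then the integral part of `X` is `∂⁻¹ f` for some
function `f`. -/
theorem exists_sub_nonneg_eq (X : PsDO D) (h : ∀ i < 0, (del 1 * X).coeff i = 0) :
    ∃ f, X - X.nonneg = del (-1) * ofFun f := by
  refine ⟨(X - X.nonneg).coeff (-1), ?_⟩
  have h1 : del 1 * (X - X.nonneg) = ofFun ((X - X.nonneg).coeff (-1)) := by
    ext i
    rw [coeff_del_one_mul, coeff_ofFun]
    rcases lt_trichotomy i 0 with hi | rfl | hi
    · rw [if_neg hi.ne, ← h i hi, coeff_del_one_mul, coeff_sub, coeff_sub, coeff_nonneg,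
        coeff_nonneg, if_neg (by omega), if_neg (by omega), sub_zero, sub_zero]
    · rw [if_pos rfl, X.orderLE_sub_nonneg 0 (by omega), map_zero, add_zero, zero_sub]
    · rw [if_neg hi.ne', X.orderLE_sub_nonneg i (by omega),
        X.orderLE_sub_nonneg (i - 1) (by omega), map_zero, add_zero]
  rw [← h1, ← mul_assoc, del_mul_del, neg_add_cancel, del_zero, one_mul]

theorem res_del_pow_mul (k : ℕ) (f : A) :
    (del 1 ^ k * (ofFun f * del (-1)) : PsDO D).res = (D^[k]) f := by
  rw [del_one_pow, res, coeff_mul, finsum_eq_single _ ((k : ℤ), k)]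
  · have h1 : Ring.choose (k : ℤ) k = 1 := by
      have := Ring.choose_natCast (R := ℤ) k k
      rw [Nat.choose_self] at this
      simpa using this
    simp [coeff_del, coeff_ofFun, h1]
  · rintro ⟨j, l⟩ h
    by_cases hj : j = k
    · have hl : -1 - j + l ≠ -1 := fun h' => h (by ext <;> simp <;> omega)
      simp only
      rw [coeff_ofFun_mul, coeff_del (-1), if_neg hl, mul_zero, iterate_map_zero]
      simp
    · simp [coeff_del, hj]

theorem res_nonneg_mul (P : PsDO D) (f : A) :
    (P.nonneg * (ofFun f * del (-1))).res = P.nonneg.apply f := by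
  obtain ⟨N, hN⟩ := P.exists_natCast_orderLE
  rw [nonneg_apply_eq_sum P hN, nonneg_eq_sum P hN, Finset.sum_mul, res, coeff_sum]
  refine Finset.sum_congr rfl fun i _ => ?_
  rw [mul_assoc, coeff_ofFun_mul]
  congr 1
  exact res_del_pow_mul i f

/-- A derivation `E` of the coefficients, applied to an operator coefficientwise. -/
def mapCoeff (E : Derivation ℂ A A) (P : PsDO D) : PsDO D :=
  ⟨fun i => E (P.coeff i), by
    obtain ⟨N, hN⟩ := P.bdd
    exact ⟨N, fun i hi => by rw [hN i hi, map_zero]⟩⟩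

@[simp] theorem coeff_mapCoeff (E : Derivation ℂ A A) (P : PsDO D) (i : ℤ) :
    (mapCoeff E P).coeff i = E (P.coeff i) := rfl

theorem OrderLE.mapCoeff {P : PsDO D} {N : ℤ} (hP : P.OrderLE N) (E : Derivation ℂ A A) :
    (P.mapCoeff E).OrderLE N := fun i hi => by rw [coeff_mapCoeff, hP i hi, map_zero]

theorem mapCoeff_mul {E : Derivation ℂ A A} (hE : ∀ a, E (D a) = D (E a)) (P Q : PsDO D) :
    mapCoeff E (P * Q) = mapCoeff E P * Q + P * mapCoeff E Q := by
  have hiter : ∀ (k : ℕ) (a : A), E ((D^[k]) a) = (D^[k]) (E a) := fun k => by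
    induction k with
    | zero => intro a; rfl
    | succ k ih => intro a; rw [Function.iterate_succ_apply, Function.iterate_succ_apply, ih, hE]
  obtain ⟨N, hN⟩ := P.bdd
  obtain ⟨M, hM⟩ := Q.bdd
  have hN' : P.OrderLE N := hN
  have hM' : Q.OrderLE M := hM
  refine ext_of_bdd (N + M) ((hN'.mul hM').mapCoeff E)
    (((hN'.mapCoeff E).mul hM').add (hN'.mul (hM'.mapCoeff E))) fun n => ?_
  rw [coeff_add, coeff_mapCoeff, coeff_mul_eq P Q hN hM, coeff_mul_eq _ Q (hN'.mapCoeff E) hM,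
    coeff_mul_eq P _ hN (hM'.mapCoeff E), map_sum, ← Finset.sum_add_distrib]
  refine Finset.sum_congr rfl fun p _ => ?_
  rw [map_sum, ← Finset.sum_add_distrib]
  refine Finset.sum_congr rfl fun r _ => ?_
  rw [map_zsmul, Derivation.leibniz, hiter, ← smul_add, coeff_mapCoeff, coeff_mapCoeff,
    smul_eq_mul, smul_eq_mul]
  congr 1
  ring

theorem mapCoeff_del (E : Derivation ℂ A A) (i : ℤ) : mapCoeff E (del i : PsDO D) = 0 := by
  ext j
  rw [coeff_mapCoeff, coeff_del]
  split_ifs <;> simp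

theorem mapCoeff_ofFun (E : Derivation ℂ A A) (a : A) :
    mapCoeff E (ofFun a : PsDO D) = ofFun (E a) := by
  ext j
  rw [coeff_mapCoeff, coeff_ofFun, coeff_ofFun]
  split_ifs <;> simp

theorem del_one_mul_eq (P : PsDO D) : del 1 * P = mapCoeff D P + P * del 1 := by
  ext i
  simp [add_comm]

end PsDO

/-! ### The bilinear residue -/

theorem expCoeffDiff_eq (n : ℕ) : expCoeffDiff n = diffHom (expCoeff n) := by
  simp [expCoeffDiff, diffHom]

/-- The coefficient of `λ^n` in `e^{ξ(t_o,λ) - ξ(t_o',λ)}`, for `n ∈ ℤ`. -/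
noncomputable def expCoeffDiffZ (n : ℤ) : PairSeries :=
  if 0 ≤ n then expCoeffDiff n.toNat else 0

theorem expCoeffDiffZ_natCast (n : ℕ) : expCoeffDiffZ n = expCoeffDiff n := by
  rw [expCoeffDiffZ, if_pos (by omega), Int.toNat_natCast]

theorem expCoeffDiffZ_of_neg {n : ℤ} (hn : n < 0) : expCoeffDiffZ n = 0 := by
  rw [expCoeffDiffZ, if_neg (by omega)]

theorem pderiv_inl_expCoeffDiffZ (k : ℕ) (n : ℤ) :
    MvPowerSeries.pderiv ℂ (Sum.inl k) (expCoeffDiffZ n) =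
      expCoeffDiffZ (n - (2 * k + 1)) := by
  rcases lt_or_ge n 0 with hn | hn
  · rw [expCoeffDiffZ_of_neg hn, expCoeffDiffZ_of_neg (by omega), map_zero]
  · lift n to ℕ using hn
    rw [expCoeffDiffZ_natCast, expCoeffDiff_eq, pderiv_inl_diffHom, dt_expCoeff]
    split_ifs with h
    · rw [show (n : ℤ) - (2 * k + 1) = (n - (2 * k + 1) : ℕ) by omega, expCoeffDiffZ_natCast,
        expCoeffDiff_eq]
    · rw [expCoeffDiffZ_of_neg (by omega), map_zero]

theorem pderiv_inr_expCoeffDiffZ (k : ℕ) (n : ℤ) :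
    MvPowerSeries.pderiv ℂ (Sum.inr k) (expCoeffDiffZ n) =
      -expCoeffDiffZ (n - (2 * k + 1)) := by
  rcases lt_or_ge n 0 with hn | hn
  · rw [expCoeffDiffZ_of_neg hn, expCoeffDiffZ_of_neg (by omega), map_zero, neg_zero]
  · lift n to ℕ using hn
    rw [expCoeffDiffZ_natCast, expCoeffDiff_eq, pderiv_inr_diffHom, dt_expCoeff]
    split_ifs with h
    · rw [show (n : ℤ) - (2 * k + 1) = (n - (2 * k + 1) : ℕ) by omega, expCoeffDiffZ_natCast,
        expCoeffDiff_eq]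
    · rw [expCoeffDiffZ_of_neg (by omega), map_zero]

theorem diagHom_expCoeffDiffZ (n : ℤ) :
    diagHom (expCoeffDiffZ n) = if n = 0 then 1 else 0 := by
  rcases lt_or_ge n 0 with hn | hn
  · rw [expCoeffDiffZ_of_neg hn, map_zero, if_neg hn.ne]
  · lift n to ℕ using hn
    have h : ∀ f : TimeSeries, diagHom (diffHom f) =
        MvPowerSeries.C (MvPowerSeries.constantCoeff f) := by
      intro f
      let ψ : TimeSeries →ₐ[ℂ] TimeSeries :=
        { MvPowerSeries.C.comp MvPowerSeries.constantCoeff with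
          commutes' := fun r => by simp [MvPowerSeries.algebraMap_apply] }
      have hψ : Continuous ψ := MvPowerSeries.WithPiTopology.continuous_C.comp
        (MvPowerSeries.WithPiTopology.continuous_constantCoeff ℂ)
      exact algHom_eq_of_eq_X (φ := diagHom.comp diffHom) (ψ := ψ)
        (continuous_diagHom.comp continuous_diffHom) hψ (by simp [ψ]) f
    rw [expCoeffDiffZ_natCast, expCoeffDiff_eq, h]
    by_cases hn : n = 0
    · simp [hn, expCoeff_zero]
    · rw [constantCoeff_expCoeff hn, if_neg (by exact_mod_cast hn), map_zero]

/-- The contribution of `U_i λ^i` and `V_j λ^j` to `Res_λ U(e^ξ)(t_o, λ) V(e^ξ)(t_o', -λ)`. -/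
noncomputable def resTerm (U V : Op) (p : ℤ × ℤ) : PairSeries :=
  ((-1 : ℂ) ^ p.2) •
    (expCoeffDiffZ (-1 - p.1 - p.2) * (leftHom (U.coeff p.1) * rightHom (V.coeff p.2)))

/-- `Res_λ U(e^ξ)(t_o, λ) V(e^ξ)(t_o', -λ)`, as a series in `t_o` and `t_o'`. -/
noncomputable def bilinRes (U V : Op) : PairSeries := ∑' p, resTerm U V p

/-- Only finitely many pairs `(i, j)` contribute to a given monomial: the orders of `U` and `V`
bound `i` and `j` above, and the weight of the monomial bounds `i + j` below. -/
theorem summable_resTerm (U V : Op) : Summable (resTerm U V) := by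
  refine MvPowerSeries.WithPiTopology.summable_iff_summable_coeff.mpr fun m => ?_
  refine summable_of_hasFiniteSupport ?_
  obtain ⟨N, hN⟩ := U.bdd
  obtain ⟨M, hM⟩ := V.bdd
  refine ((Set.finite_Icc (-1 - M - Finsupp.weight pairWeight m) N).prod
    (Set.finite_Icc (-1 - N - Finsupp.weight pairWeight m) M)).subset ?_
  rintro ⟨i, j⟩ h
  have hi : i ≤ N := by
    by_contra hi
    exact h (by simp [resTerm, hN i (by omega)])
  have hj : j ≤ M := by
    by_contra hj
    exact h (by simp [resTerm, hM j (by omega)])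
  have hw : -1 - i - j ≤ Finsupp.weight pairWeight m := by
    by_contra hw
    refine h ?_
    simp only [resTerm, MvPowerSeries.coeff_smul]
    rw [expCoeffDiffZ, if_pos (by omega), coeff_expCoeffDiff_mul _ _ _ (by omega), mul_zero]
  simp only [Set.mem_prod, Set.mem_Icc]
  omega

theorem resTerm_add_left (U U' V : Op) (p : ℤ × ℤ) :
    resTerm (U + U') V p = resTerm U V p + resTerm U' V p := by
  simp only [resTerm, PsDO.coeff_add, map_add, add_mul, mul_add, smul_add]

theorem resTerm_add_right (U V V' : Op) (p : ℤ × ℤ) :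
    resTerm U (V + V') p = resTerm U V p + resTerm U V' p := by
  simp only [resTerm, PsDO.coeff_add, map_add, mul_add, smul_add]

theorem bilinRes_add_left (U U' V : Op) :
    bilinRes (U + U') V = bilinRes U V + bilinRes U' V := by
  simp only [bilinRes, resTerm_add_left]
  exact (summable_resTerm U V).tsum_add (summable_resTerm U' V)

theorem bilinRes_add_right (U V V' : Op) :
    bilinRes U (V + V') = bilinRes U V + bilinRes U V' := by
  simp only [bilinRes, resTerm_add_right]
  exact (summable_resTerm U V).tsum_add (summable_resTerm U V')

theorem bilinRes_sub_left (U U' V : Op) :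
    bilinRes (U - U') V = bilinRes U V - bilinRes U' V := by
  rw [eq_sub_iff_add_eq, ← bilinRes_add_left, sub_add_cancel]

theorem bilinRes_sub_right (U V V' : Op) :
    bilinRes U (V - V') = bilinRes U V - bilinRes U V' := by
  rw [eq_sub_iff_add_eq, ← bilinRes_add_right, sub_add_cancel]

theorem bilinRes_ofFun_mul_left (a : TimeSeries) (U V : Op) :
    bilinRes (PsDO.ofFun a * U) V = leftHom a * bilinRes U V := by
  rw [bilinRes, bilinRes, ← (summable_resTerm U V).tsum_mul_left]
  refine tsum_congr fun p => ?_
  rw [resTerm, resTerm, PsDO.coeff_ofFun_mul, map_mul, mul_smul_comm]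
  congr 1
  ring

theorem bilinRes_ofFun_mul_right (a : TimeSeries) (U V : Op) :
    bilinRes U (PsDO.ofFun a * V) = rightHom a * bilinRes U V := by
  rw [bilinRes, bilinRes, ← (summable_resTerm U V).tsum_mul_left]
  refine tsum_congr fun p => ?_
  rw [resTerm, resTerm, PsDO.coeff_ofFun_mul, map_mul, mul_smul_comm]
  congr 1
  ring

theorem bilinRes_zero_left (V : Op) : bilinRes 0 V = 0 := by
  have := bilinRes_sub_left 0 0 V
  rwa [sub_zero, sub_self] at this

theorem bilinRes_zero_right (U : Op) : bilinRes U 0 = 0 := by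
  have := bilinRes_sub_right U 0 0
  rwa [sub_zero, sub_self] at this

theorem bilinRes_sum_left {ι : Type*} (s : Finset ι) (f : ι → Op) (V : Op) :
    bilinRes (∑ i ∈ s, f i) V = ∑ i ∈ s, bilinRes (f i) V := by
  classical
  induction s using Finset.induction_on with
  | empty => simp [bilinRes_zero_left]
  | insert a s ha ih => rw [Finset.sum_insert ha, Finset.sum_insert ha, bilinRes_add_left, ih]

theorem bilinRes_sum_right {ι : Type*} (s : Finset ι) (f : ι → Op) (U : Op) :
    bilinRes U (∑ i ∈ s, f i) = ∑ i ∈ s, bilinRes U (f i) := by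
  classical
  induction s using Finset.induction_on with
  | empty => simp [bilinRes_zero_right]
  | insert a s ha ih => rw [Finset.sum_insert ha, Finset.sum_insert ha, bilinRes_add_right, ih]

/-- The operator `U_{t_{2n+1}} + U ∂^{2n+1}`, which describes the derivative of `U(e^ξ)` with respect
to `t_{2n+1}`. -/
noncomputable def flow (n : ℕ) (U : Op) : Op :=
  PsDO.mapCoeff (dt n) U + U * PsDO.del (2 * n + 1)

theorem flow_zero (U : Op) : flow 0 U = PsDO.del 1 * U := by
  rw [flow, PsDO.del_one_mul_eq]
  simp

theorem pderiv_inl_resTerm (n : ℕ) (U V : Op) (p : ℤ × ℤ) :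
    MvPowerSeries.pderiv ℂ (Sum.inl n) (resTerm U V p) =
      resTerm (PsDO.mapCoeff (dt n) U) V p +
        resTerm (U * PsDO.del (2 * n + 1)) V (p.1 + (2 * n + 1), p.2) := by
  simp only [resTerm, Derivation.map_smul, Derivation.leibniz, pderiv_inl_expCoeffDiffZ,
    pderiv_inl_leftHom, pderiv_inl_rightHom, PsDO.coeff_mapCoeff, PsDO.coeff_mul_del,
    smul_eq_mul, mul_zero, zero_add, add_sub_cancel_right, ← smul_add]
  rw [show -1 - p.1 - p.2 - (2 * (n : ℤ) + 1) = -1 - (p.1 + (2 * n + 1)) - p.2 by ring]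
  congr 1
  ring

theorem pderiv_inr_resTerm (n : ℕ) (U V : Op) (p : ℤ × ℤ) :
    MvPowerSeries.pderiv ℂ (Sum.inr n) (resTerm U V p) =
      resTerm U (PsDO.mapCoeff (dt n) V) p +
        resTerm U (V * PsDO.del (2 * n + 1)) (p.1, p.2 + (2 * n + 1)) := by
  have hs : (-1 : ℂ) ^ (p.2 + (2 * (n : ℤ) + 1)) = -(-1 : ℂ) ^ p.2 := by
    rw [zpow_add₀ (by norm_num), Odd.neg_one_zpow ⟨n, rfl⟩, mul_neg, mul_one]
  simp only [resTerm, Derivation.map_smul, Derivation.leibniz, pderiv_inr_expCoeffDiffZ,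
    pderiv_inr_leftHom, pderiv_inr_rightHom, PsDO.coeff_mapCoeff, PsDO.coeff_mul_del,
    smul_eq_mul, mul_zero, add_zero, add_sub_cancel_right, hs, neg_smul, ← smul_neg, ← smul_add]
  rw [show -1 - p.1 - p.2 - (2 * (n : ℤ) + 1) = -1 - p.1 - (p.2 + (2 * n + 1)) by ring]
  congr 1
  ring

theorem pderiv_inl_bilinRes (n : ℕ) (U V : Op) :
    MvPowerSeries.pderiv ℂ (Sum.inl n) (bilinRes U V) = bilinRes (flow n U) V := by
  rw [bilinRes, (summable_resTerm U V).map_tsum _ (continuous_pderiv _)]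
  simp only [pderiv_inl_resTerm]
  let e : ℤ × ℤ ≃ ℤ × ℤ := (Equiv.addRight (2 * (n : ℤ) + 1)).prodCongr (Equiv.refl ℤ)
  have h1 : ∑' p : ℤ × ℤ, resTerm (U * PsDO.del (2 * n + 1)) V (p.1 + (2 * n + 1), p.2) =
      bilinRes (U * PsDO.del (2 * n + 1)) V :=
    e.tsum_eq (resTerm (U * PsDO.del (2 * n + 1)) V)
  have h2 : Summable fun p : ℤ × ℤ =>
      resTerm (U * PsDO.del (2 * n + 1)) V (p.1 + (2 * n + 1), p.2) :=
    e.summable_iff.mpr (summable_resTerm (U * PsDO.del (2 * n + 1)) V)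
  rw [(summable_resTerm _ V).tsum_add h2, h1, flow, bilinRes_add_left]
  rfl

theorem pderiv_inr_bilinRes (n : ℕ) (U V : Op) :
    MvPowerSeries.pderiv ℂ (Sum.inr n) (bilinRes U V) = bilinRes U (flow n V) := by
  rw [bilinRes, (summable_resTerm U V).map_tsum _ (continuous_pderiv _)]
  simp only [pderiv_inr_resTerm]
  let e : ℤ × ℤ ≃ ℤ × ℤ := (Equiv.refl ℤ).prodCongr (Equiv.addRight (2 * (n : ℤ) + 1))
  have h1 : ∑' p : ℤ × ℤ, resTerm U (V * PsDO.del (2 * n + 1)) (p.1, p.2 + (2 * n + 1)) =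
      bilinRes U (V * PsDO.del (2 * n + 1)) :=
    e.tsum_eq (resTerm U (V * PsDO.del (2 * n + 1)))
  have h2 : Summable fun p : ℤ × ℤ =>
      resTerm U (V * PsDO.del (2 * n + 1)) (p.1, p.2 + (2 * n + 1)) :=
    e.summable_iff.mpr (summable_resTerm U (V * PsDO.del (2 * n + 1)))
  rw [(summable_resTerm U _).tsum_add h2, h1, flow, bilinRes_add_right]
  rfl

theorem bilinRes_del_pow_mul_left (k : ℕ) (U V : Op) : bilinRes (PsDO.del 1 ^ k * U) V =
    ((MvPowerSeries.pderiv ℂ (Sum.inl 0) : PairSeries → PairSeries)^[k]) (bilinRes U V) := by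
  induction k with
  | zero => simp
  | succ k ih =>
    rw [pow_succ', mul_assoc, ← flow_zero, ← pderiv_inl_bilinRes, ih, Function.iterate_succ_apply']

theorem bilinRes_del_pow_mul_right (k : ℕ) (U V : Op) : bilinRes U (PsDO.del 1 ^ k * V) =
    ((MvPowerSeries.pderiv ℂ (Sum.inr 0) : PairSeries → PairSeries)^[k]) (bilinRes U V) := by
  induction k with
  | zero => simp
  | succ k ih =>
    rw [pow_succ', mul_assoc, ← flow_zero, ← pderiv_inr_bilinRes, ih, Function.iterate_succ_apply']

/-- If the bilinear residue depends only on `t_o`, then a differential operator acting on the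
first argument acts on it as on a function. -/
theorem bilinRes_nonneg_mul_left {U V : Op} {f : TimeSeries} (h : bilinRes U V = leftHom f)
    (P : Op) : bilinRes (P.nonneg * U) V = leftHom (P.nonneg.apply f) := by
  obtain ⟨N, hN⟩ := P.exists_natCast_orderLE
  have hk : ∀ k : ℕ, ((MvPowerSeries.pderiv ℂ (Sum.inl 0) : PairSeries → PairSeries)^[k])
      (leftHom f) = leftHom (((dt 0)^[k]) f) := fun k => by
    induction k with
    | zero => rfl
    | succ k ih =>
      rw [Function.iterate_succ_apply', ih, pderiv_inl_leftHom, Function.iterate_succ_apply']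
  rw [PsDO.nonneg_eq_sum P hN, Finset.sum_mul, bilinRes_sum_left,
    ← PsDO.nonneg_eq_sum P hN, PsDO.nonneg_apply_eq_sum P hN, map_sum]
  refine Finset.sum_congr rfl fun i _ => ?_
  rw [mul_assoc, bilinRes_ofFun_mul_left, bilinRes_del_pow_mul_left, h, hk, map_mul]

theorem bilinRes_nonneg_mul_left_eq_zero {U V : Op} (h : bilinRes U V = 0) (P : Op) :
    bilinRes (P.nonneg * U) V = 0 := by
  obtain ⟨N, hN⟩ := P.exists_natCast_orderLE
  rw [PsDO.nonneg_eq_sum P hN, Finset.sum_mul, bilinRes_sum_left]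
  refine Finset.sum_eq_zero fun i _ => ?_
  rw [mul_assoc, bilinRes_ofFun_mul_left, bilinRes_del_pow_mul_left, h, iterate_map_zero, mul_zero]

theorem bilinRes_nonneg_mul_right_eq_zero {U V : Op} (h : bilinRes U V = 0) (P : Op) :
    bilinRes U (P.nonneg * V) = 0 := by
  obtain ⟨N, hN⟩ := P.exists_natCast_orderLE
  rw [PsDO.nonneg_eq_sum P hN, Finset.sum_mul, bilinRes_sum_right]
  refine Finset.sum_eq_zero fun i _ => ?_
  rw [mul_assoc, bilinRes_ofFun_mul_right, bilinRes_del_pow_mul_right, h, iterate_map_zero,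
    mul_zero]

theorem diagHom_resTerm (U V : Op) (p : ℤ × ℤ) : diagHom (resTerm U V p) =
    if p.1 + p.2 = -1 then (-1 : ℂ) ^ p.2 • (U.coeff p.1 * V.coeff p.2) else 0 := by
  rw [resTerm, map_smul, map_mul, map_mul, diagHom_leftHom, diagHom_rightHom,
    diagHom_expCoeffDiffZ]
  by_cases h : p.1 + p.2 = -1
  · rw [if_pos h, if_pos (by omega), one_mul]
  · rw [if_neg h, if_neg (by omega), zero_mul, smul_zero]

/-- On the diagonal, only the leading coefficients of two operators with orders adding up to
`-1` contribute to the residue. -/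
theorem diagHom_bilinRes {U V : Op} {N M : ℤ} (hU : U.OrderLE N) (hV : V.OrderLE M)
    (h : N + M = -1) : diagHom (bilinRes U V) = (-1 : ℂ) ^ M • (U.coeff N * V.coeff M) := by
  rw [bilinRes, (summable_resTerm U V).map_tsum _ continuous_diagHom, tsum_eq_single (N, M)]
  · rw [diagHom_resTerm, if_pos h]
  · rintro ⟨i, j⟩ hij
    rw [diagHom_resTerm]
    split_ifs with h1
    · simp only at h1 ⊢
      by_cases hi : N < i
      · rw [hU i hi, zero_mul, smul_zero]
      · by_cases hj : M < j
        · rw [hV j hj, mul_zero, smul_zero]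
        · exact absurd (by ext <;> simp <;> omega) hij
    · rfl

/-! ### Symbols of operators of nonpositive order -/

theorem coeff_eq_coeff_lamCoeff (u : LamSeries) (d : Option ℕ →₀ ℕ) :
    MvPowerSeries.coeff d u = MvPowerSeries.coeff d.some (lamCoeff u (d none)) := by
  rw [lamCoeff, MvPowerSeries.coeff_coeff_optionEquivLeft, Finsupp.optionElim_some]

theorem lamCoeff_sub (u v : LamSeries) (j : ℕ) :
    lamCoeff (u - v) j = lamCoeff u j - lamCoeff v j := by simp [lamCoeff]

theorem optionEquivLeft_inclHom (f : TimeSeries) :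
    MvPowerSeries.optionEquivLeft ℕ ℂ (inclHom f) = PowerSeries.C f := by
  ext n x
  rw [MvPowerSeries.coeff_coeff_optionEquivLeft, PowerSeries.coeff_C]
  split_ifs with hn
  · rw [hn, show x.optionElim 0 = x.embDomain Function.Embedding.some by
      ext (_ | i)
      · rw [Finsupp.optionElim_apply_none, Finsupp.embDomain_some_none]
      · rw [Finsupp.optionElim_apply_some, Finsupp.embDomain_some_some]]
    exact MvPowerSeries.coeff_embDomain_rename _ f x
  · rw [map_zero]
    refine MvPowerSeries.coeff_rename_eq_zero _ f ?_
    rintro ⟨y, hy⟩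
    rw [← Finsupp.embDomain_eq_mapDomain] at hy
    have := DFunLike.congr_fun hy none
    rw [Finsupp.embDomain_some_none, Finsupp.optionElim_apply_none] at this
    exact hn this.symm

theorem optionEquivLeft_lamInv : MvPowerSeries.optionEquivLeft ℕ ℂ lamInv = PowerSeries.X := by
  simp [lamInv]

theorem lamCoeff_inclHom_mul (f : TimeSeries) (u : LamSeries) (j : ℕ) :
    lamCoeff (inclHom f * u) j = f * lamCoeff u j := by
  rw [lamCoeff, lamCoeff, map_mul, optionEquivLeft_inclHom, PowerSeries.coeff_C_mul]

theorem lamCoeff_lamInv_pow (a j : ℕ) : lamCoeff (lamInv ^ a) j = if j = a then 1 else 0 := by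
  rw [lamCoeff, map_pow, optionEquivLeft_lamInv, PowerSeries.coeff_X_pow]

theorem hasSum_lamCoeff (u : LamSeries) :
    HasSum (fun j : ℕ => inclHom (lamCoeff u j) * lamInv ^ j) u := by
  refine MvPowerSeries.WithPiTopology.hasSum_iff_hasSum_coeff.mpr fun d => ?_
  have h : ∀ j : ℕ, MvPowerSeries.coeff d (inclHom (lamCoeff u j) * lamInv ^ j) =
      if d none = j then MvPowerSeries.coeff d u else 0 := by
    intro j
    rw [coeff_eq_coeff_lamCoeff, lamCoeff_inclHom_mul, lamCoeff_lamInv_pow]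
    split_ifs with h
    · rw [mul_one, ← h, ← coeff_eq_coeff_lamCoeff]
    · rw [mul_zero, map_zero]
  simp only [h]
  have := hasSum_single (f := fun j => if d none = j then MvPowerSeries.coeff d u else 0)
    (d none) (fun j hj => if_neg hj.symm)
  simpa using this

theorem coeff_symbolOp_neg (u : LamSeries) (j : ℕ) :
    (symbolOp u).coeff (-j) = lamCoeff u j := by
  simp [symbolOp]

theorem orderLE_symbolOp (u : LamSeries) : (symbolOp u).OrderLE 0 := fun i hi => by
  simp [symbolOp, hi]

theorem exists_symbolOp_eq {U : Op} (hU : U.OrderLE 0) : ∃ u, symbolOp u = U := by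
  refine ⟨(MvPowerSeries.optionEquivLeft ℕ ℂ).symm (PowerSeries.mk fun j => U.coeff (-j)), ?_⟩
  ext i
  rcases lt_or_ge 0 i with hi | hi
  · rw [orderLE_symbolOp _ i hi, hU i hi]
  · obtain ⟨j, rfl⟩ : ∃ j : ℕ, i = -j := ⟨(-i).toNat, by omega⟩
    rw [coeff_symbolOp_neg, lamCoeff, AlgEquiv.apply_symm_apply, PowerSeries.coeff_mk]

theorem symbolOp_sub (u v : LamSeries) : symbolOp (u - v) = symbolOp u - symbolOp v := by
  ext i
  rcases lt_or_ge 0 i with hi | hi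
  · rw [PsDO.coeff_sub, orderLE_symbolOp _ i hi, orderLE_symbolOp _ i hi,
      orderLE_symbolOp _ i hi, sub_zero]
  · obtain ⟨j, rfl⟩ : ∃ j : ℕ, i = -j := ⟨(-i).toNat, by omega⟩
    rw [PsDO.coeff_sub, coeff_symbolOp_neg, coeff_symbolOp_neg, coeff_symbolOp_neg, lamCoeff_sub]

theorem symbolOp_inclHom_mul (f : TimeSeries) (u : LamSeries) :
    symbolOp (inclHom f * u) = PsDO.ofFun f * symbolOp u := by
  ext i
  rw [PsDO.coeff_ofFun_mul]
  rcases lt_or_ge 0 i with hi | hi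
  · rw [orderLE_symbolOp _ i hi, orderLE_symbolOp _ i hi, mul_zero]
  · obtain ⟨j, rfl⟩ : ∃ j : ℕ, i = -j := ⟨(-i).toNat, by omega⟩
    rw [coeff_symbolOp_neg, coeff_symbolOp_neg, lamCoeff_inclHom_mul]

theorem resTerm_symbolOp (u v : LamSeries) (a b : ℕ) :
    resTerm (symbolOp u) (symbolOp v) (-a, -b) = ((-1 : ℂ) ^ b) •
      (expCoeffDiffZ (a + b - 1) * (leftHom (lamCoeff u a) * rightHom (lamCoeff v b))) := by
  rw [resTerm]
  simp only [coeff_symbolOp_neg]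
  rw [zpow_neg, zpow_natCast, ← inv_pow, show (-1 : ℂ)⁻¹ = -1 by norm_num,
    show -1 - (-(a : ℤ)) - (-b) = a + b - 1 by ring]

theorem summable_resTerm_symbolOp (u v : LamSeries) :
    Summable fun x : ℕ × ℕ => resTerm (symbolOp u) (symbolOp v) (-x.1, -x.2) := by
  refine (summable_resTerm (symbolOp u) (symbolOp v)).comp_injective
    (i := fun x : ℕ × ℕ => ((-x.1, -x.2) : ℤ × ℤ)) ?_
  rintro ⟨a, b⟩ ⟨c, d⟩ h
  simpa using h

theorem bilinRes_symbolOp (u v : LamSeries) : bilinRes (symbolOp u) (symbolOp v) =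
    ∑' x : ℕ × ℕ, resTerm (symbolOp u) (symbolOp v) (-x.1, -x.2) := by
  have hinj : Function.Injective (fun x : ℕ × ℕ => ((-x.1, -x.2) : ℤ × ℤ)) := by
    rintro ⟨a, b⟩ ⟨c, d⟩ h
    simpa using h
  refine (hinj.tsum_eq fun p hp => ?_).symm
  refine ⟨((-p.1).toNat, (-p.2).toNat), ?_⟩
  have h1 : p.1 ≤ 0 := by
    by_contra h
    exact hp (by simp [resTerm, orderLE_symbolOp u _ (not_le.mp h)])
  have h2 : p.2 ≤ 0 := by
    by_contra h
    exact hp (by simp [resTerm, orderLE_symbolOp v _ (not_le.mp h)])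
  ext <;> simp <;> omega

theorem summable_and_tsum_antidiagonal {α : Type*} [AddCommGroup α] [TopologicalSpace α]
    [IsTopologicalAddGroup α] [T3Space α] {f : ℕ × ℕ → α} (hf : Summable f) :
    (Summable fun n => ∑ x ∈ Finset.HasAntidiagonal.antidiagonal n, f x) ∧
      ∑' x, f x = ∑' n, ∑ x ∈ Finset.HasAntidiagonal.antidiagonal n, f x := by
  have hf' : Summable fun x : Σ n : ℕ, Finset.HasAntidiagonal.antidiagonal n => f x.2 :=
    Finset.HasAntidiagonal.sigmaAntidiagonalEquivProd.summable_iff.mpr hf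
  have h : ∀ n, ∑' x : Finset.HasAntidiagonal.antidiagonal n, f x =
      ∑ x ∈ Finset.HasAntidiagonal.antidiagonal n, f x := fun n => by
    rw [tsum_fintype]
    exact Finset.sum_coe_sort (Finset.HasAntidiagonal.antidiagonal n) f
  constructor
  · simp only [← h]
    exact hf'.sigma' fun n => (hasSum_fintype _).summable
  · simp only [← h]
    rw [← Finset.HasAntidiagonal.sigmaAntidiagonalEquivProd.tsum_eq]
    exact hf'.tsum_sigma' fun n => (hasSum_fintype _).summable

theorem tsum_eq_tsum_antidiagonal_succ {α : Type*} [AddCommGroup α] [TopologicalSpace α]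
    [IsTopologicalAddGroup α] [T3Space α] {f : ℕ × ℕ → α} (hf : Summable f) (h0 : f (0, 0) = 0) :
    (Summable fun n => ∑ x ∈ Finset.HasAntidiagonal.antidiagonal (n + 1), f x) ∧
      ∑' x, f x = ∑' n, ∑ x ∈ Finset.HasAntidiagonal.antidiagonal (n + 1), f x := by
  obtain ⟨h1, h2⟩ := summable_and_tsum_antidiagonal hf
  obtain ⟨F, hF⟩ : ∃ F : ℕ → α, ∀ n, ∑ x ∈ Finset.HasAntidiagonal.antidiagonal n, f x = F n :=
    ⟨_, fun _ => rfl⟩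
  have hF0 : F 0 = 0 := by
    rw [← hF, Finset.HasAntidiagonal.antidiagonal_zero, Finset.sum_singleton, h0]
  simp only [hF] at h1 h2 ⊢
  exact ⟨(summable_nat_add_iff 1).mpr h1, by rw [h2, h1.tsum_eq_zero_add, hF0, zero_add]⟩

theorem sum_antidiagonal_resTerm (u v : LamSeries) (n : ℕ) :
    ∑ x ∈ Finset.HasAntidiagonal.antidiagonal (n + 1),
      resTerm (symbolOp u) (symbolOp v) (-x.1, -x.2) = expCoeffDiff n * pairCoeff u v n := by
  rw [pairCoeff, Finset.mul_sum]
  refine Finset.sum_congr rfl fun x hx => ?_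
  rw [Finset.HasAntidiagonal.mem_antidiagonal] at hx
  rw [resTerm_symbolOp, show ((x.1 : ℤ) + x.2 - 1) = (n : ℕ) by omega, expCoeffDiffZ_natCast,
    mul_smul_comm]
  rfl

/-- On operators of nonpositive order, the two definitions of the residue agree: summation over
pairs of exponents and summation over the powers of `λ` in the exponential factor. -/
theorem bilinRes_symbolOp_eq_lamRes (u v : LamSeries) :
    bilinRes (symbolOp u) (symbolOp v) = lamRes u v := by
  obtain ⟨hs, h⟩ := tsum_eq_tsum_antidiagonal_succ (summable_resTerm_symbolOp u v) (by
    have := resTerm_symbolOp u v 0 0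
    rw [expCoeffDiffZ_of_neg (by simp), zero_mul, smul_zero] at this
    exact this)
  simp only [sum_antidiagonal_resTerm] at hs h
  ext m
  have h4 := (MvPowerSeries.WithPiTopology.hasSum_iff_hasSum_coeff.mp hs.hasSum m).tsum_eq
  rw [bilinRes_symbolOp, h, ← h4, tsum_eq_finsum]
  · rfl
  · refine (Set.finite_Iic (Finsupp.weight pairWeight m)).subset fun n hn => ?_
    by_contra h
    exact hn (coeff_expCoeffDiff_mul n _ m (not_le.mp h))

theorem hasSum_flipHom_lamCoeff (v : LamSeries) :
    HasSum (fun j : ℕ => shiftHom (lamCoeff v j) * (-lamInv) ^ j) (flipHom v) := by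
  have h := (hasSum_lamCoeff v).map flipHom continuous_flipHom
  refine h.congr_fun fun j => ?_
  rw [Function.comp_apply, map_mul, map_pow, flipHom_inclHom, flipHom_lamInv]

theorem hasSum_mul_flipHom (u v : LamSeries) :
    HasSum (fun x : ℕ × ℕ => (inclHom (lamCoeff u x.1) * lamInv ^ x.1) *
      (shiftHom (lamCoeff v x.2) * (-lamInv) ^ x.2)) (u * flipHom v) := by
  have hmul := (hasSum_lamCoeff u).mul (hasSum_flipHom_lamCoeff v)
  refine hmul ?_
  refine MvPowerSeries.WithPiTopology.summable_iff_summable_coeff.mpr fun d => ?_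
  refine summable_of_hasFiniteSupport ?_
  refine ((Set.finite_Iic (d none)).prod (Set.finite_Iic (d none))).subset ?_
  rintro ⟨a, b⟩ h
  have hab : a + b ≤ d none := by
    by_contra hab
    have hdvd : (MvPowerSeries.X none : LamSeries) ^ (a + b) ∣
        (inclHom (lamCoeff u a) * lamInv ^ a) * (shiftHom (lamCoeff v b) * (-lamInv) ^ b) := by
      refine ⟨inclHom (lamCoeff u a) * shiftHom (lamCoeff v b) * (-1) ^ b, ?_⟩
      change _ = lamInv ^ (a + b) * _
      rw [neg_pow lamInv b]
      ring
    exact h (MvPowerSeries.X_pow_dvd_iff.mp hdvd d (not_le.mp hab))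
  exact Set.mem_prod.mpr ⟨Set.mem_Iic.mpr (by simp only; omega),
    Set.mem_Iic.mpr (by simp only; omega)⟩

/-- The term `a, b` of the residue at `t_o' = t_o - 2[λ⁻¹]_o` is twice the corresponding term of
the product of the symbols, except for `a + b ≤ 1`. -/
theorem lamInv_mul_miwaHom_resTerm (u v : LamSeries) (a b : ℕ) : lamInv *
    miwaHom (resTerm (symbolOp u) (symbolOp v) (-a, -b)) =
      (if a + b = 0 then 0 else if a + b = 1 then 1 else 2) *
        ((inclHom (lamCoeff u a) * lamInv ^ a) * (shiftHom (lamCoeff v b) * (-lamInv) ^ b)) := by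
  have hsm : ∀ f : LamSeries, (-1 : ℂ) ^ b • f = (-1) ^ b * f := fun f => by
    rcases Nat.even_or_odd b with h | h <;> simp [h.neg_one_pow]
  rw [resTerm_symbolOp, map_smul, map_mul, map_mul, miwaHom_leftHom, miwaHom_rightHom, hsm,
    neg_pow lamInv b]
  rcases Nat.eq_zero_or_pos (a + b) with h0 | hpos
  · rw [expCoeffDiffZ_of_neg (by omega), if_pos h0, map_zero]
    ring
  · obtain ⟨n, hn⟩ : ∃ n, a + b = n + 1 := ⟨a + b - 1, by omega⟩
    have hpow : lamInv * lamInv ^ n = lamInv ^ a * lamInv ^ b := by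
      rw [← pow_succ', ← hn, pow_add]
    have hcay : cayleyCoeff n • lamInv ^ n =
        (if a + b = 0 then 0 else if a + b = 1 then 1 else 2) * lamInv ^ n := by
      rw [cayleyCoeff, if_neg hpos.ne']
      by_cases hn0 : n = 0
      · rw [if_pos hn0, if_pos (by omega), one_smul, one_mul]
      · rw [if_neg hn0, if_neg (by omega), two_smul, two_mul]
    rw [show (a : ℤ) + b - 1 = n by omega, expCoeffDiffZ_natCast, miwaHom_expCoeffDiff, hcay]
    linear_combination (if a + b = 0 then 0 else if a + b = 1 then 1 else 2) * (-1) ^ b *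
      inclHom (lamCoeff u a) * shiftHom (lamCoeff v b) * hpow

/-- The specialization `t_o' = t_o - 2[λ⁻¹]_o` of the bilinear residue of two operators of order
at most `0`: since `e^{ξ(2[μ⁻¹]_o, λ)} = (1 + λ/μ) / (1 - λ/μ)`, the residue picks out
the product of the symbols at `λ = μ`, up to the first terms. -/
theorem lamInv_mul_miwaHom_bilinRes (u v : LamSeries) :
    lamInv * miwaHom (bilinRes (symbolOp u) (symbolOp v)) =
      2 * (u * flipHom v) - 2 * (inclHom (lamCoeff u 0) * shiftHom (lamCoeff v 0)) -
      lamInv * (inclHom (lamCoeff u 1) * shiftHom (lamCoeff v 0) -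
        inclHom (lamCoeff u 0) * shiftHom (lamCoeff v 1)) := by
  let g : ℕ × ℕ → LamSeries := fun x => (inclHom (lamCoeff u x.1) * lamInv ^ x.1) *
    (shiftHom (lamCoeff v x.2) * (-lamInv) ^ x.2)
  let c : ℕ × ℕ → LamSeries := fun x =>
    (if x.1 + x.2 = 0 then 2 else if x.1 + x.2 = 1 then 1 else 0) * g x
  have hc := hasSum_sum_of_ne_finset_zero (f := c) (L := SummationFilter.unconditional _)
    (s := {(0, 0), (1, 0), (0, 1)}) (by
      rintro ⟨a, b⟩ hx
      simp only [Finset.mem_insert, Finset.mem_singleton, not_or, Prod.mk.injEq] at hx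
      simp only [c]
      rw [if_neg (by omega), if_neg (by omega), zero_mul])
  rw [Finset.sum_insert (by simp), Finset.sum_insert (by simp), Finset.sum_singleton] at hc
  have hL : HasSum (fun x : ℕ × ℕ => lamInv *
      miwaHom (resTerm (symbolOp u) (symbolOp v) (-x.1, -x.2)))
      (lamInv * miwaHom (bilinRes (symbolOp u) (symbolOp v))) := by
    have h1 := (summable_resTerm_symbolOp u v).hasSum
    rw [← bilinRes_symbolOp] at h1
    exact (h1.map miwaHom continuous_miwaHom).mul_left lamInv
  have hterm : ∀ x : ℕ × ℕ, lamInv *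
      miwaHom (resTerm (symbolOp u) (symbolOp v) (-x.1, -x.2)) = 2 * g x - c x := by
    rintro ⟨a, b⟩
    rw [lamInv_mul_miwaHom_resTerm]
    simp only [c, g]
    split_ifs <;> ring
  have hR := ((hasSum_mul_flipHom u v).mul_left 2).sub hc
  rw [hL.unique (hR.congr_fun hterm)]
  simp only [c, g]
  norm_num
  ring

/-! ### Consequences of the bilinear identity for the dressing operator -/

/-- The operator `W = 1 + w₁ ∂⁻¹ + ⋯` is a dressing operator of the CKP hierarchy: its wave
function `W(e^ξ)` satisfies the bilinear identity. -/
structure IsCKPDressing (W : Op) : Prop where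
  orderLE : W.OrderLE 0
  coeff_zero : W.coeff 0 = 1
  bilin : bilinRes W W = 0

/-- The Lax operator `W ∂ W⁻¹`. -/
noncomputable def laxOf (W : Op) : Op := W * PsDO.del 1 * Ring.inverse W

/-- The operator `∂⁻¹ q W`, whose wave function is the potential `Ω(q, ψ)` of `q` and of
`ψ = W(e^ξ)`. -/
noncomputable def potentialOp (q : TimeSeries) (W : Op) : Op :=
  PsDO.del (-1) * PsDO.ofFun q * W

theorem flow_mul (n : ℕ) (P U : Op) :
    flow n (P * U) = PsDO.mapCoeff (dt n) P * U + P * flow n U := by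
  rw [flow, flow, PsDO.mapCoeff_mul (fun a => pderiv_comm _ _ a), mul_add, mul_assoc, add_assoc]

theorem mapCoeff_del_mul_ofFun (n : ℕ) (i : ℤ) (q : TimeSeries) :
    PsDO.mapCoeff (dt n) (PsDO.del i * PsDO.ofFun q : Op) =
      PsDO.del i * PsDO.ofFun (dt n q) := by
  rw [PsDO.mapCoeff_mul (fun a => pderiv_comm _ _ a), PsDO.mapCoeff_del, PsDO.mapCoeff_ofFun,
    zero_mul, zero_add]

theorem del_one_mul_potentialOp (q : TimeSeries) (W : Op) :
    PsDO.del 1 * potentialOp q W = PsDO.ofFun q * W := by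
  rw [potentialOp, ← mul_assoc, ← mul_assoc, PsDO.del_mul_del, add_neg_cancel, PsDO.del_zero,
    one_mul]

theorem diagHom_iterate_pderiv_inl (k : ℕ) {F : PairSeries}
    (hF : MvPowerSeries.pderiv ℂ (Sum.inr 0) F = 0) :
    diagHom (((MvPowerSeries.pderiv ℂ (Sum.inl 0) : PairSeries → PairSeries)^[k]) F) =
      ((dt 0)^[k]) (diagHom F) := by
  induction k generalizing F with
  | zero => rfl
  | succ k ih =>
    rw [Function.iterate_succ_apply, Function.iterate_succ_apply, ih, dt_diagHom, hF, map_zero,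
      add_zero]
    rw [pderiv_comm, hF, map_zero]

theorem diagHom_bilinRes_nonneg_mul_left {U V : Op}
    (h : MvPowerSeries.pderiv ℂ (Sum.inr 0) (bilinRes U V) = 0) (P : Op) :
    diagHom (bilinRes (P.nonneg * U) V) = P.nonneg.apply (diagHom (bilinRes U V)) := by
  obtain ⟨N, hN⟩ := P.exists_natCast_orderLE
  rw [PsDO.nonneg_eq_sum P hN, Finset.sum_mul, bilinRes_sum_left,
    ← PsDO.nonneg_eq_sum P hN, PsDO.nonneg_apply_eq_sum P hN, map_sum]
  refine Finset.sum_congr rfl fun i _ => ?_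
  rw [mul_assoc, bilinRes_ofFun_mul_left, bilinRes_del_pow_mul_left, map_mul, diagHom_leftHom,
    diagHom_iterate_pderiv_inl i h]

theorem nonneg_apply_neg (P : Op) (f : TimeSeries) :
    P.nonneg.apply (-f) = -P.nonneg.apply f := by
  obtain ⟨N, hN⟩ := P.exists_natCast_orderLE
  rw [PsDO.nonneg_apply_eq_sum P hN, PsDO.nonneg_apply_eq_sum P hN, ← Finset.sum_neg_distrib]
  refine Finset.sum_congr rfl fun i _ => ?_
  rw [iterate_map_neg, mul_neg]

namespace IsCKPDressing

variable {W : Op}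

theorem isUnit (hW : IsCKPDressing W) : IsUnit W :=
  PsDO.isUnit_of_monic hW.orderLE hW.coeff_zero

theorem laxOf_pow_mul (hW : IsCKPDressing W) (n : ℕ) :
    laxOf W ^ n * W = W * PsDO.del n := by
  induction n with
  | zero => simp [PsDO.del_zero]
  | succ n ih =>
    rw [pow_succ, mul_assoc, laxOf, mul_assoc (W * PsDO.del 1),
      Ring.inverse_mul_cancel _ hW.isUnit, mul_one, ← laxOf, ← mul_assoc, ih, mul_assoc,
      PsDO.del_mul_del]
    push_cast
    rfl

/-- The pairing with `W` is nondegenerate on integral operators: if the leading term of `Q` is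
`c ∂^{-m}`, then the residue of `W` and `∂^{m-1} Q` restricts to `-c` on the diagonal. -/
theorem eq_zero_of_bilinRes_eq_zero (hW : IsCKPDressing W) {Q : Op} (hQ : Q.OrderLE (-1))
    (h : bilinRes W Q = 0) : Q = 0 := by
  have key : ∀ m : ℕ, Q.OrderLE (-1 - m) := by
    intro m
    induction m with
    | zero => simpa using hQ
    | succ m ih =>
      intro i hi
      rcases eq_or_ne i (-1 - m) with rfl | hne
      · have hdel : (PsDO.del m : Op).OrderLE m := PsDO.orderLE_del _
        have hord : (PsDO.del 1 ^ m * Q).OrderLE (-1) := by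
          rw [PsDO.del_one_pow]
          exact (hdel.mul ih).mono (by omega)
        have h1 := diagHom_bilinRes hW.orderLE hord (by norm_num)
        have h2 : (PsDO.del 1 ^ m * Q).coeff (-1) = Q.coeff (-1 - m) := by
          have := PsDO.coeff_mul_top hdel ih
          rw [PsDO.coeff_del, if_pos rfl, one_mul, add_sub_cancel] at this
          rw [PsDO.del_one_pow, this]
        rw [bilinRes_del_pow_mul_right, h, iterate_map_zero, map_zero, hW.coeff_zero, h2,
          one_mul] at h1
        simpa using h1.symm
      · exact ih i (by push_cast at hi; omega)
  refine PsDO.ext fun i => ?_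
  exact key (-i).toNat i (by omega)

/-- The Sato–Wilson equations, in the form `ψ_{t_m} = (L^m)_{≥0} ψ` with `m = 2n+1`: both sides
have residue zero with `ψ`, and their difference is an integral operator applied to `e^ξ`. -/
theorem flow_eq (hW : IsCKPDressing W) (n : ℕ) :
    flow n W = (laxOf W ^ (2 * n + 1)).nonneg * W := by
  set L := laxOf W ^ (2 * n + 1) with hL
  have h1 : flow n W - L.nonneg * W = PsDO.mapCoeff (dt n) W + (L - L.nonneg) * W := by
    have := hW.laxOf_pow_mul (2 * n + 1)
    push_cast at this
    rw [flow, ← this, sub_mul]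
    abel
  have h2 : (PsDO.mapCoeff (dt n) W).OrderLE (-1) := by
    intro i hi
    rcases eq_or_ne i 0 with rfl | hi0
    · rw [PsDO.coeff_mapCoeff, hW.coeff_zero, Derivation.map_one_eq_zero]
    · rw [PsDO.coeff_mapCoeff, hW.orderLE i (by omega), map_zero]
  rw [← sub_eq_zero]
  refine hW.eq_zero_of_bilinRes_eq_zero ?_ ?_
  · rw [h1]
    exact h2.add ((L.orderLE_sub_nonneg.mul hW.orderLE).mono (by norm_num))
  · rw [bilinRes_sub_right, bilinRes_nonneg_mul_right_eq_zero hW.bilin, ← pderiv_inr_bilinRes,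
      hW.bilin, map_zero, sub_zero]

theorem orderLE_potentialOp (hW : IsCKPDressing W) (q : TimeSeries) :
    (potentialOp q W).OrderLE (-1) :=
  ((PsDO.orderLE_del (-1)).mul (PsDO.orderLE_ofFun q)).mul hW.orderLE |>.mono (by norm_num)

theorem coeff_potentialOp (hW : IsCKPDressing W) (q : TimeSeries) :
    (potentialOp q W).coeff (-1) = q := by
  have h1 : (PsDO.del (-1) * PsDO.ofFun q : Op).OrderLE (-1) :=
    ((PsDO.orderLE_del (-1)).mul (PsDO.orderLE_ofFun q)).mono (by norm_num)
  have h2 := PsDO.coeff_mul_top h1 hW.orderLE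
  have h3 := PsDO.coeff_mul_top (PsDO.orderLE_del (D := dt 0) (-1)) (PsDO.orderLE_ofFun q)
  rw [add_zero] at h2 h3
  rw [potentialOp, h2, h3, hW.coeff_zero, PsDO.coeff_del, PsDO.coeff_ofFun]
  simp

/-- The operator `∂⁻¹ (q_{t_m} + q (L^m)_{≥0})` with `m = 2n+1`, which applied to `ψ` gives the
derivative of `Ω(q, ψ)` with respect to `t_m`. -/
noncomputable def potentialFlow (W : Op) (q : TimeSeries) (n : ℕ) : Op :=
  PsDO.del (-1) * (PsDO.ofFun (dt n q) + PsDO.ofFun q * (laxOf W ^ (2 * n + 1)).nonneg)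

theorem flow_potentialOp (hW : IsCKPDressing W) (q : TimeSeries) (n : ℕ) :
    flow n (potentialOp q W) = potentialFlow W q n * W := by
  rw [potentialOp, flow_mul, mapCoeff_del_mul_ofFun, hW.flow_eq, potentialFlow, mul_add, add_mul]
  simp only [mul_assoc]

variable {q : TimeSeries}

/-- For an eigenfunction `q`, the operator `∂⁻¹ (q_{t_m} + q (L^m)_{≥0})` is a differential
operator. Its integral part is `∂⁻¹ f`; the residue of `ψ` and `Ω(q, ψ)` restricts to `-q` on the
diagonal, and differentiating this along `t_m` gives `f = 0`. -/
theorem potentialFlow_eq_nonneg (hW : IsCKPDressing W) (hq : IsEigenfunction (laxOf W) q)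
    (n : ℕ) : potentialFlow W q n = (potentialFlow W q n).nonneg := by
  set X := potentialFlow W q n with hX
  obtain ⟨f, hf⟩ := X.exists_sub_nonneg_eq (by
    intro i hi
    rw [hX, potentialFlow, ← mul_assoc, PsDO.del_mul_del, add_neg_cancel, PsDO.del_zero, one_mul,
      PsDO.coeff_add, PsDO.coeff_ofFun, if_neg hi.ne, PsDO.coeff_ofFun_mul, PsDO.coeff_nonneg,
      if_neg (by omega), mul_zero, add_zero])
  -- `∂ X = q_{t_m} + q (L^m)_{≥0}` is differential, so the integral part of `X` is `∂⁻¹ f`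
  suffices hf0 : f = 0 by
    rw [← sub_eq_zero, hf, hf0]
    ext i
    have h0 : (PsDO.ofFun 0 : Op) = 0 := by
      ext j
      simp [PsDO.coeff_ofFun]
    rw [h0, mul_zero]
  have hdiag : ∀ g : TimeSeries, diagHom (bilinRes W (potentialOp g W)) = -g := by
    intro g
    rw [diagHom_bilinRes hW.orderLE (hW.orderLE_potentialOp g) (by norm_num), hW.coeff_zero,
      hW.coeff_potentialOp]
    simp
  have hinr : MvPowerSeries.pderiv ℂ (Sum.inr 0) (bilinRes W (potentialOp q W)) = 0 := by
    rw [pderiv_inr_bilinRes, flow_zero, del_one_mul_potentialOp, bilinRes_ofFun_mul_right,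
      hW.bilin, mul_zero]
  have h := dt_diagHom n (bilinRes W (potentialOp q W))
  rw [pderiv_inl_bilinRes, pderiv_inr_bilinRes, hW.flow_eq, diagHom_bilinRes_nonneg_mul_left hinr,
    hW.flow_potentialOp, ← hX, ← sub_add_cancel X X.nonneg, add_mul, bilinRes_add_right,
    bilinRes_nonneg_mul_right_eq_zero hW.bilin, add_zero, hf, ← potentialOp, hdiag, hdiag,
    nonneg_apply_neg, map_neg, hq n, left_eq_add, neg_eq_zero] at h
  exact h

theorem flow_potentialOp_eq_nonneg_mul (hW : IsCKPDressing W) (hq : IsEigenfunction (laxOf W) q)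
    (n : ℕ) : flow n (potentialOp q W) = (potentialFlow W q n).nonneg * W := by
  rw [hW.flow_potentialOp, ← hW.potentialFlow_eq_nonneg hq]

/-- `Res_λ ψ(t_o, λ) Ω(q, ψ)(t_o', -λ) = -q(t_o)`. -/
theorem bilinRes_potentialOp_right (hW : IsCKPDressing W) (hq : IsEigenfunction (laxOf W) q) :
    bilinRes W (potentialOp q W) = leftHom (-q) := by
  rw [← sub_eq_zero]
  refine eq_zero_of_pderiv_inr (fun n => ?_) ?_
  · rw [map_sub, pderiv_inr_bilinRes, hW.flow_potentialOp_eq_nonneg_mul hq,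
      bilinRes_nonneg_mul_right_eq_zero hW.bilin, pderiv_inr_leftHom, sub_zero]
  · rw [map_sub, diagHom_bilinRes hW.orderLE (hW.orderLE_potentialOp q) (by norm_num),
      hW.coeff_zero, hW.coeff_potentialOp, diagHom_leftHom]
    simp

/-- `Res_λ Ω(q, ψ)(t_o, λ) ψ(t_o', -λ) = q(t_o')`. -/
theorem bilinRes_potentialOp_left (hW : IsCKPDressing W) (hq : IsEigenfunction (laxOf W) q) :
    bilinRes (potentialOp q W) W = rightHom q := by
  rw [← sub_eq_zero]
  refine eq_zero_of_pderiv_inl (fun n => ?_) ?_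
  · rw [map_sub, pderiv_inl_bilinRes, hW.flow_potentialOp_eq_nonneg_mul hq,
      bilinRes_nonneg_mul_left_eq_zero hW.bilin, pderiv_inl_rightHom, sub_zero]
  · rw [map_sub, diagHom_bilinRes (hW.orderLE_potentialOp q) hW.orderLE (by norm_num),
      hW.coeff_zero, hW.coeff_potentialOp, diagHom_rightHom]
    simp

/-- The defining equations of `Ω(q, q)`: its flows are those of `Ω(q, ψ)` with `ψ` replaced
by `q`. -/
theorem dt_potential (hW : IsCKPDressing W) (hq : IsEigenfunction (laxOf W) q) {Ω : TimeSeries}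
    (hΩ : IsSEP (laxOf W) q q Ω) (n : ℕ) :
    dt n Ω = (potentialFlow W q n).nonneg.apply q := by
  have h1 : (PsDO.del (-1) * PsDO.ofFun (dt n q) * (PsDO.ofFun q * PsDO.del (-1)) : Op).res =
      0 :=
    (((PsDO.orderLE_del (-1)).mul (PsDO.orderLE_ofFun _)).mul
      ((PsDO.orderLE_ofFun q).mul (PsDO.orderLE_del (-1)))) (-1) (by norm_num)
  rw [hΩ n, ← PsDO.res_nonneg_mul, ← hW.potentialFlow_eq_nonneg hq, potentialFlow, mul_add,
    add_mul]
  rw [PsDO.res] at h1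
  rw [PsDO.res, PsDO.res, PsDO.coeff_add, h1, zero_add]
  simp only [mul_assoc]

/-- `Res_λ Ω(q, ψ)(t_o, λ) Ω(q, ψ)(t_o', -λ) = Ω(q, q)(t_o') - Ω(q, q)(t_o)`. -/
theorem bilinRes_potentialOp_potentialOp (hW : IsCKPDressing W)
    (hq : IsEigenfunction (laxOf W) q) {Ω : TimeSeries} (hΩ : IsSEP (laxOf W) q q Ω) :
    bilinRes (potentialOp q W) (potentialOp q W) = rightHom Ω - leftHom Ω := by
  rw [← sub_eq_zero]
  refine eq_zero_of_pderiv_inl (fun n => ?_) ?_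
  · rw [map_sub, map_sub, pderiv_inl_bilinRes, hW.flow_potentialOp_eq_nonneg_mul hq,
      bilinRes_nonneg_mul_left (hW.bilinRes_potentialOp_right hq), pderiv_inl_rightHom,
      pderiv_inl_leftHom, hW.dt_potential hq hΩ, nonneg_apply_neg, map_neg]
    ring
  · rw [map_sub, map_sub, diagHom_rightHom, diagHom_leftHom, sub_self, sub_zero,
      diagHom_bilinRes ((hW.orderLE_potentialOp q).mono (by norm_num : (-1 : ℤ) ≤ 0))
        (hW.orderLE_potentialOp q) (by norm_num), hW.orderLE_potentialOp q 0 (by norm_num),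
      zero_mul, smul_zero]

theorem dt_zero_potential (hW : IsCKPDressing W) (hq : IsEigenfunction (laxOf W) q)
    {Ω : TimeSeries} (hΩ : IsSEP (laxOf W) q q Ω) : dt 0 Ω = q ^ 2 := by
  have h := congrArg (fun F => diagHom (MvPowerSeries.pderiv ℂ (Sum.inl 0) F))
    (hW.bilinRes_potentialOp_potentialOp hq hΩ)
  simp only [pderiv_inl_bilinRes, flow_zero, del_one_mul_potentialOp, bilinRes_ofFun_mul_left,
    hW.bilinRes_potentialOp_right hq, map_mul, map_sub, pderiv_inl_rightHom, pderiv_inl_leftHom,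
    diagHom_leftHom, map_zero] at h
  linear_combination h

/-- The Darboux transformed dressing operator is `W - Ω⁻¹ q (∂⁻¹ q W)`. -/
theorem darbouxOp_mul (q Ω : TimeSeries) (W : Op) :
    darbouxOp q Ω * W = W - PsDO.ofFun (Ω⁻¹ * q) * potentialOp q W := by
  rw [darbouxOp, sub_mul, one_mul, potentialOp]
  simp only [mul_assoc]

/-- The Darboux transformation preserves the bilinear identity. -/
theorem bilinRes_darbouxOp_mul (hW : IsCKPDressing W) (hq : IsEigenfunction (laxOf W) q)
    {Ω : TimeSeries} (hΩ : IsSEP (laxOf W) q q Ω) (hΩ0 : MvPowerSeries.constantCoeff Ω ≠ 0) :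
    bilinRes (darbouxOp q Ω * W) (darbouxOp q Ω * W) = 0 := by
  have hl : leftHom Ω⁻¹ * leftHom Ω = 1 := by
    rw [← map_mul, MvPowerSeries.inv_mul_cancel _ hΩ0, map_one]
  have hr : rightHom Ω⁻¹ * rightHom Ω = 1 := by
    rw [← map_mul, MvPowerSeries.inv_mul_cancel _ hΩ0, map_one]
  rw [darbouxOp_mul, bilinRes_sub_left, bilinRes_sub_right, bilinRes_sub_right,
    bilinRes_ofFun_mul_left, bilinRes_ofFun_mul_left, bilinRes_ofFun_mul_right,
    bilinRes_ofFun_mul_right, hW.bilin, hW.bilinRes_potentialOp_left hq,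
    hW.bilinRes_potentialOp_right hq, hW.bilinRes_potentialOp_potentialOp hq hΩ, map_mul,
    map_mul, map_neg]
  linear_combination leftHom Ω⁻¹ * leftHom q * rightHom q * hr -
    rightHom Ω⁻¹ * leftHom q * rightHom q * hl

end IsCKPDressing

/-! ### The Chang–Wu wave function -/

theorem continuous_lamCoeff (j : ℕ) : Continuous (fun u : LamSeries => lamCoeff u j) := by
  refine continuous_pi fun d => ?_
  have h : ∀ u : LamSeries, lamCoeff u j d = MvPowerSeries.coeff (d.optionElim j) u :=
    fun u => MvPowerSeries.coeff_coeff_optionEquivLeft u j d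
  simp only [h]
  exact MvPowerSeries.WithPiTopology.continuous_coeff ℂ _

/-- The specialization `λ⁻¹ = 0`. -/
noncomputable def zeroHom : LamSeries →ₐ[ℂ] TimeSeries :=
  { (PowerSeries.constantCoeff (R := TimeSeries)).comp
      (MvPowerSeries.optionEquivLeft ℕ ℂ : LamSeries →+* PowerSeries TimeSeries) with
    commutes' := fun r => by simp [MvPowerSeries.algebraMap_apply] }

theorem zeroHom_eq_lamCoeff (u : LamSeries) : zeroHom u = lamCoeff u 0 := by
  rw [lamCoeff, PowerSeries.coeff_zero_eq_constantCoeff_apply]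
  rfl

theorem continuous_zeroHom : Continuous zeroHom := by
  have h : ⇑zeroHom = fun u => lamCoeff u 0 := funext zeroHom_eq_lamCoeff
  rw [h]
  exact continuous_lamCoeff 0

@[simp] theorem zeroHom_X_some (n : ℕ) :
    zeroHom (MvPowerSeries.X (some n)) = MvPowerSeries.X n := by
  rw [zeroHom_eq_lamCoeff, lamCoeff, MvPowerSeries.optionEquivLeft_X_some,
    PowerSeries.coeff_zero_C]

@[simp] theorem zeroHom_lamInv : zeroHom lamInv = 0 := by
  rw [zeroHom_eq_lamCoeff, lamCoeff, optionEquivLeft_lamInv, PowerSeries.coeff_zero_X]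

@[simp] theorem zeroHom_inclHom (f : TimeSeries) : zeroHom (inclHom f) = f :=
  algHom_eq_of_eq_X (φ := zeroHom.comp inclHom) (ψ := AlgHom.id ℂ _)
    (continuous_zeroHom.comp continuous_inclHom) continuous_id (by simp) f

@[simp] theorem zeroHom_shiftHom (f : TimeSeries) : zeroHom (shiftHom f) = f :=
  algHom_eq_of_eq_X (φ := zeroHom.comp shiftHom) (ψ := AlgHom.id ℂ _)
    (continuous_zeroHom.comp continuous_shiftHom) continuous_id (by simp [shiftedTime]) f

theorem constantCoeff_zeroHom (u : LamSeries) :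
    MvPowerSeries.constantCoeff (zeroHom u) = MvPowerSeries.constantCoeff u := by
  refine constantCoeff_algHom continuous_zeroHom (fun s => ?_) u
  cases s with
  | none =>
    change MvPowerSeries.constantCoeff (zeroHom lamInv) = 0
    rw [zeroHom_lamInv, map_zero]
  | some n => simp

theorem constantCoeff_sqrtOne {f : LamSeries} (hf : MvPowerSeries.constantCoeff f = 1) :
    MvPowerSeries.constantCoeff (sqrtOne f) = 1 := by
  have h : PowerSeries.HasSubst (f - 1) :=
    PowerSeries.HasSubst.of_constantCoeff_zero (by simp [hf])
  have h1 := constantCoeff_algHom (continuous_substAlgHom h.const)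
    (fun s => by rw [MvPowerSeries.substAlgHom_X]; simp [hf])
    (PowerSeries.binomialSeries ℂ (1 / 2 : ℂ))
  rw [MvPowerSeries.substAlgHom_apply] at h1
  refine h1.trans ?_
  change PowerSeries.constantCoeff (PowerSeries.binomialSeries ℂ (1 / 2 : ℂ)) = 1
  simp

/-- Square roots of power series are determined by their constant terms. -/
theorem eq_of_sq_eq_sq {σ : Type*} {f g : MvPowerSeries σ ℂ} (h : f ^ 2 = g ^ 2)
    (hf : MvPowerSeries.constantCoeff f = 1) (hg : MvPowerSeries.constantCoeff g = 1) :
    f = g := by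
  rcases eq_or_eq_neg_of_sq_eq_sq f g h with h1 | h1
  · exact h1
  · rw [h1, map_neg, hg] at hf
    norm_num at hf

theorem zeroHom_sqrtOne {f : LamSeries} (hf : zeroHom f = 1) : zeroHom (sqrtOne f) = 1 := by
  have hc : MvPowerSeries.constantCoeff f = 1 := by
    rw [← constantCoeff_zeroHom, hf, map_one]
  refine eq_of_sq_eq_sq ?_ ?_ (map_one _)
  · rw [← map_pow, sqrtOne_sq f hc, hf, one_pow]
  · rw [constantCoeff_zeroHom, constantCoeff_sqrtOne hc]

/-- A series with nonzero constant term has a square root. -/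
theorem exists_sq_eq (Ω : TimeSeries) (hΩ : MvPowerSeries.constantCoeff Ω ≠ 0) :
    ∃ s : TimeSeries, s ^ 2 = Ω := by
  obtain ⟨c, hc⟩ := IsAlgClosed.exists_pow_nat_eq (MvPowerSeries.constantCoeff Ω) (n := 2)
    (by norm_num)
  have h1 : MvPowerSeries.constantCoeff
      (inclHom ((MvPowerSeries.constantCoeff Ω)⁻¹ • Ω)) = 1 := by
    rw [constantCoeff_inclHom, MvPowerSeries.constantCoeff_smul, smul_eq_mul, inv_mul_cancel₀ hΩ]
  refine ⟨c • zeroHom (sqrtOne (inclHom ((MvPowerSeries.constantCoeff Ω)⁻¹ • Ω))), ?_⟩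
  rw [smul_pow, ← map_pow, sqrtOne_sq _ h1, zeroHom_inclHom, hc, smul_smul, mul_inv_cancel₀ hΩ,
    one_smul]

section TauFunction

variable {τ : TimeSeries}

theorem tauRatio_mul_inclHom (hτ : MvPowerSeries.constantCoeff τ ≠ 0) :
    tauRatio τ * inclHom τ = shiftHom τ := by
  rw [tauRatio, shift_eq, incl_eq, mul_assoc,
    MvPowerSeries.inv_mul_cancel _ (by rwa [constantCoeff_inclHom]), mul_one]

theorem ne_zero_of_constantCoeff_ne_zero {σ : Type*} {f : MvPowerSeries σ ℂ}
    (hf : MvPowerSeries.constantCoeff f ≠ 0) : f ≠ 0 := by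
  rintro rfl
  exact hf (map_zero _)

theorem zeroHom_tauRatio (hτ : MvPowerSeries.constantCoeff τ ≠ 0) : zeroHom (tauRatio τ) = 1 := by
  have h := congrArg zeroHom (tauRatio_mul_inclHom hτ)
  rw [map_mul, zeroHom_inclHom, zeroHom_shiftHom] at h
  exact mul_right_cancel₀ (ne_zero_of_constantCoeff_ne_zero hτ) (h.trans (one_mul τ).symm)

theorem constantCoeff_tauRatio (hτ : MvPowerSeries.constantCoeff τ ≠ 0) :
    MvPowerSeries.constantCoeff (tauRatio τ) = 1 := by
  rw [← constantCoeff_zeroHom, zeroHom_tauRatio hτ, map_one]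

theorem zeroHom_cwWave (hτ : MvPowerSeries.constantCoeff τ ≠ 0) : zeroHom (cwWave τ) = 1 := by
  rw [cwWave, map_mul, zeroHom_tauRatio hτ, zeroHom_sqrtOne, one_mul]
  simp

theorem constantCoeff_cwWave (hτ : MvPowerSeries.constantCoeff τ ≠ 0) :
    MvPowerSeries.constantCoeff (cwWave τ) = 1 := by
  rw [← constantCoeff_zeroHom, zeroHom_cwWave hτ, map_one]

theorem isCKPDressing_dressing (hτ : IsCKPTau τ) : IsCKPDressing (dressing τ) where
  orderLE := orderLE_symbolOp _
  coeff_zero := by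
    have := coeff_symbolOp_neg (cwWave τ) 0
    rw [← zeroHom_eq_lamCoeff, zeroHom_cwWave hτ.1] at this
    rw [dressing]
    simpa using this
  bilin := by rw [dressing, bilinRes_symbolOp_eq_lamRes, hτ.2]

/-- `1 + λ⁻¹ ∂_x log (τ(t_o - 2[λ⁻¹]_o) / τ(t_o))`. -/
noncomputable def cwFactor (τ : TimeSeries) : LamSeries :=
  1 + lamInv * (MvPowerSeries.pderiv ℂ (some 0) (tauRatio τ) * (tauRatio τ)⁻¹)

theorem zeroHom_cwFactor (τ : TimeSeries) : zeroHom (cwFactor τ) = 1 := by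
  simp [cwFactor]

theorem constantCoeff_cwFactor (τ : TimeSeries) :
    MvPowerSeries.constantCoeff (cwFactor τ) = 1 := by
  rw [← constantCoeff_zeroHom, zeroHom_cwFactor, map_one]

theorem cwWave_sq_eq (τ : TimeSeries) : cwWave τ ^ 2 = cwFactor τ * tauRatio τ ^ 2 := by
  rw [cwWave, mul_pow, ← cwFactor, sqrtOne_sq _ (constantCoeff_cwFactor τ)]

theorem two_mul_cwWave_sq (hτ : MvPowerSeries.constantCoeff τ ≠ 0) : 2 * cwWave τ ^ 2 =
    2 * tauRatio τ ^ 2 + lamInv * MvPowerSeries.pderiv ℂ (some 0) (tauRatio τ ^ 2) := by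
  have h2 : ∀ f : LamSeries, 2 * ((1 / 2 : ℂ) • f) = f := fun f => by
    rw [two_mul, ← add_smul]
    norm_num
  rw [cwWave_sq τ hτ, mul_add, h2]

theorem flipHom_tauRatio (hτ : MvPowerSeries.constantCoeff τ ≠ 0) :
    flipHom (tauRatio τ) = (tauRatio τ)⁻¹ := by
  have hc : MvPowerSeries.constantCoeff (tauRatio τ) ≠ 0 := by
    rw [constantCoeff_tauRatio hτ]
    exact one_ne_zero
  have h1 := tauRatio_mul_inclHom hτ
  have h2 := congrArg flipHom h1
  rw [map_mul, flipHom_inclHom, flipHom_shiftHom] at h2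
  have hne : shiftHom τ ≠ 0 := ne_zero_of_constantCoeff_ne_zero (by
    rwa [constantCoeff_shiftHom])
  rw [MvPowerSeries.eq_inv_iff_mul_eq_one hc]
  refine mul_right_cancel₀ hne ?_
  linear_combination tauRatio τ * h2 + h1

/-- The factor `1 + λ⁻¹ ∂_x log ρ` with `ρ = τ(t_o - 2[λ⁻¹]_o) / τ(t_o)` is invariant under
`(t_o, λ) ↦ (t_o - 2[λ⁻¹]_o, -λ)`, because this substitution inverts `ρ`. -/
theorem flipHom_cwFactor (hτ : MvPowerSeries.constantCoeff τ ≠ 0) :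
    flipHom (cwFactor τ) = cwFactor τ := by
  have hc : MvPowerSeries.constantCoeff (tauRatio τ) ≠ 0 := by
    rw [constantCoeff_tauRatio hτ]
    exact one_ne_zero
  have h1 := MvPowerSeries.mul_inv_cancel _ hc
  have h2 : flipHom (tauRatio τ)⁻¹ = tauRatio τ := by
    rw [← flipHom_tauRatio hτ, flipHom_flipHom]
  rw [cwFactor, map_add, map_one, map_mul, map_mul, flipHom_lamInv, ← pderiv_flipHom,
    flipHom_tauRatio hτ, h2, MvPowerSeries.pderiv_inv']
  linear_combination lamInv * (tauRatio τ)⁻¹ * MvPowerSeries.pderiv ℂ (some 0) (tauRatio τ) * h1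

/-- `ψ(t_o, λ) ψ(t_o - 2[λ⁻¹]_o, -λ)`, up to the exponential factor. -/
theorem cwWave_mul_flipHom (hτ : MvPowerSeries.constantCoeff τ ≠ 0) :
    cwWave τ * flipHom (cwWave τ) = cwFactor τ := by
  have hc : MvPowerSeries.constantCoeff (tauRatio τ) ≠ 0 := by
    rw [constantCoeff_tauRatio hτ]
    exact one_ne_zero
  have h1 := MvPowerSeries.mul_inv_cancel _ hc
  refine eq_of_sq_eq_sq ?_ ?_ (constantCoeff_cwFactor τ)
  · rw [mul_pow, ← map_pow, cwWave_sq_eq, map_mul, map_pow, flipHom_cwFactor hτ,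
      flipHom_tauRatio hτ]
    linear_combination cwFactor τ ^ 2 * (tauRatio τ * (tauRatio τ)⁻¹ + 1) * h1
  · rw [map_mul, constantCoeff_flipHom, constantCoeff_cwWave hτ, one_mul]

end TauFunction

/-! ### The Darboux transformation of tau functions -/

theorem lamInv_ne_zero : lamInv ≠ 0 := by
  intro h
  have := congrArg (fun u => lamCoeff u 1) h
  simp [lamCoeff, optionEquivLeft_lamInv] at this

section Darboux

variable {τ q Ω s : TimeSeries}

/-- The three bilinear identities at `t_o' = t_o - 2[λ⁻¹]_o`, where `u` is the symbol of the
potential `Ω(q, ψ)`. -/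
theorem exists_potential_symbol (hτ : IsCKPTau τ) (hq : IsEigenfunction (lax τ) q)
    (hΩ : IsSEP (lax τ) q q Ω) :
    ∃ u : LamSeries, symbolOp u = potentialOp q (dressing τ) ∧ zeroHom u = 0 ∧
      2 * (u * flipHom (cwWave τ)) = lamInv * (inclHom q + shiftHom q) ∧
      2 * (cwWave τ * flipHom u) = -(lamInv * (inclHom q + shiftHom q)) ∧
      2 * (u * flipHom u) = lamInv * (shiftHom Ω - inclHom Ω) := by
  have hW := isCKPDressing_dressing hτ
  obtain ⟨u, hu⟩ := exists_symbolOp_eq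
    ((hW.orderLE_potentialOp q).mono (by norm_num : (-1 : ℤ) ≤ 0))
  have hu0 : lamCoeff u 0 = 0 := by
    rw [← coeff_symbolOp_neg, hu, hW.orderLE_potentialOp q _ (by norm_num)]
  have hu1 : lamCoeff u 1 = q := by
    rw [← coeff_symbolOp_neg, hu, Nat.cast_one, hW.coeff_potentialOp]
  have hw0 : lamCoeff (cwWave τ) 0 = 1 := by rw [← zeroHom_eq_lamCoeff, zeroHom_cwWave hτ.1]
  have h1 := lamInv_mul_miwaHom_bilinRes u (cwWave τ)
  have h2 := lamInv_mul_miwaHom_bilinRes (cwWave τ) u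
  have h3 := lamInv_mul_miwaHom_bilinRes u u
  rw [hu, ← dressing, hW.bilinRes_potentialOp_left hq, miwaHom_rightHom, hu0, hu1, hw0, map_zero,
    map_one] at h1
  rw [hu, ← dressing, hW.bilinRes_potentialOp_right hq, miwaHom_leftHom, hu0, hu1, hw0, map_zero,
    map_one, map_neg] at h2
  rw [hu, hW.bilinRes_potentialOp_potentialOp hq hΩ, map_sub, miwaHom_leftHom, miwaHom_rightHom,
    hu0, map_zero, map_zero] at h3
  refine ⟨u, hu, by rw [zeroHom_eq_lamCoeff, hu0], ?_, ?_, ?_⟩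
  · linear_combination -h1
  · linear_combination -h2
  · linear_combination -h3

/-- The Darboux transformed wave function is the Chang–Wu wave function of `Ω^{1/2} τ`: both
are normalized, and the identities for the potentials at `t_o' = t_o - 2[λ⁻¹]_o` show that their
squares agree. -/
theorem cwWave_mul_eq (hτ : IsCKPTau τ) (hq : IsEigenfunction (lax τ) q)
    (hΩ : IsSEP (lax τ) q q Ω) (hΩ0 : MvPowerSeries.constantCoeff Ω ≠ 0) (hs : s ^ 2 = Ω)
    {u : LamSeries} (hu0 : zeroHom u = 0)
    (h1 : 2 * (u * flipHom (cwWave τ)) = lamInv * (inclHom q + shiftHom q))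
    (h2 : 2 * (cwWave τ * flipHom u) = -(lamInv * (inclHom q + shiftHom q)))
    (h3 : 2 * (u * flipHom u) = lamInv * (shiftHom Ω - inclHom Ω)) :
    cwWave (s * τ) = cwWave τ - inclHom (Ω⁻¹ * q) * u := by
  have hs0 : MvPowerSeries.constantCoeff s ≠ 0 := by
    intro h
    rw [← hs, map_pow, h] at hΩ0
    exact hΩ0 (by norm_num)
  have hsτ0 : MvPowerSeries.constantCoeff (s * τ) ≠ 0 := by
    rw [map_mul]
    exact mul_ne_zero hs0 hτ.1
  have hX := cwWave_mul_flipHom hτ.1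
  have hXne : cwFactor τ ≠ 0 := ne_zero_of_constantCoeff_ne_zero (by
    rw [constantCoeff_cwFactor]
    exact one_ne_zero)
  have hOne : inclHom Ω ≠ 0 := ne_zero_of_constantCoeff_ne_zero (by rwa [constantCoeff_inclHom])
  have hO : inclHom (Ω⁻¹ * q) * inclHom Ω = inclHom q := by
    rw [← map_mul, mul_right_comm, MvPowerSeries.inv_mul_cancel _ hΩ0, one_mul]
  have hΩx := (isCKPDressing_dressing hτ).dt_zero_potential hq hΩ
  have h2ne : (2 : LamSeries) ≠ 0 := ne_zero_of_constantCoeff_ne_zero (by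
    rw [map_ofNat MvPowerSeries.constantCoeff 2]
    exact two_ne_zero)
  -- the tau quotient of `Ω^{1/2} τ`, squared, and its derivative
  have hR : tauRatio (s * τ) ^ 2 * inclHom Ω = tauRatio τ ^ 2 * shiftHom Ω := by
    have e1 := tauRatio_mul_inclHom hsτ0
    have e2 := tauRatio_mul_inclHom hτ.1
    rw [map_mul, map_mul] at e1
    have e3 : tauRatio (s * τ) * inclHom s = tauRatio τ * shiftHom s := by
      refine mul_right_cancel₀ (b := inclHom τ) (ne_zero_of_constantCoeff_ne_zero (by
        rw [constantCoeff_inclHom]; exact hτ.1)) ?_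
      linear_combination e1 - shiftHom s * e2
    rw [← hs, map_pow, map_pow, ← mul_pow, ← mul_pow, e3]
  have hRx := congrArg (MvPowerSeries.pderiv ℂ (some 0)) hR
  rw [Derivation.leibniz, Derivation.leibniz, pderiv_inclHom, pderiv_shiftHom, hΩx,
    map_pow inclHom, map_pow shiftHom] at hRx
  simp only [smul_eq_mul] at hRx
  have hw1 := two_mul_cwWave_sq hsτ0
  have hw := two_mul_cwWave_sq hτ.1
  have hw' := cwWave_sq_eq τ
  refine eq_of_sq_eq_sq ?_ (constantCoeff_cwWave hsτ0) ?_
  swap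
  · rw [← constantCoeff_zeroHom, map_sub, map_mul, hu0, mul_zero, sub_zero, zeroHom_cwWave hτ.1,
      map_one]
  generalize hv : inclHom (Ω⁻¹ * q) = v at *
  generalize inclHom q = a at *
  generalize shiftHom q = b at *
  generalize inclHom Ω = O at *
  generalize shiftHom Ω = Os at *
  generalize MvPowerSeries.pderiv ℂ (some 0) (tauRatio (s * τ) ^ 2) = R1x at *
  generalize MvPowerSeries.pderiv ℂ (some 0) (tauRatio τ ^ 2) = Rx at *
  generalize tauRatio (s * τ) ^ 2 = R1 at *
  generalize tauRatio τ ^ 2 = R at *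
  generalize cwWave (s * τ) = w1 at *
  generalize flipHom (cwWave τ) = w' at *
  generalize flipHom u = u' at *
  generalize cwWave τ = w at *
  generalize cwFactor τ = X at *
  -- in this notation `X = 1 + λ⁻¹ ∂_x log ρ`; `E1` and `E2` eliminate `w' = flipHom w` and `u'`
  have E1 : 2 * X * u = lamInv * (a + b) * w := by
    linear_combination w * h1 - 2 * u * hX
  have E2 : 2 * X * (O - Os) = lamInv * (a + b) ^ 2 := by
    refine mul_left_cancel₀ lamInv_ne_zero ?_
    linear_combination 2 * X * h3 - 2 * w * u' * h1 - lamInv * (a + b) * h2 + 4 * u * u' * hX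
  -- the square of `O` times the transformed wave function, found by squaring `E1`
  have E3 : 2 * (O * w - a * u) ^ 2 =
      R * (2 * O ^ 2 * X - 2 * O * a * lamInv * (a + b) + a ^ 2 * lamInv * (O - Os)) := by
    refine mul_left_cancel₀ (mul_ne_zero h2ne (pow_ne_zero 2 hXne)) ?_
    linear_combination (2 * X * O - a * lamInv * (a + b)) ^ 2 * hw' - X * R * a ^ 2 * lamInv * E2 -
      a * (4 * X * O * w - 2 * a * X * u - a * lamInv * (a + b) * w) * E1
  refine mul_left_cancel₀ (mul_ne_zero h2ne (pow_ne_zero 2 hOne)) ?_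
  linear_combination O ^ 2 * hw1 + (2 * O - lamInv * a ^ 2) * hR + lamInv * O * hRx +
    O * Os * (2 * hw' - hw) - E3 - R * O * E2 + 2 * u * (2 * O * w - a * u - v * O * u) * hO

end Darboux

end CKP

theorem theorem1p1 (τ q Ω : CKP.TimeSeries)
    (hτ : CKP.IsCKPTau τ)
    (hq : CKP.IsEigenfunction (CKP.lax τ) q)
    (hΩ : CKP.IsSEP (CKP.lax τ) q q Ω)
    (hΩ0 : MvPowerSeries.constantCoeff Ω ≠ 0) :
    (∃ s : CKP.TimeSeries, s ^ 2 = Ω) ∧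
    ∀ s : CKP.TimeSeries, s ^ 2 = Ω →
      CKP.IsCKPTau (s * τ) ∧
      CKP.dressing (s * τ) = CKP.darbouxOp q Ω * CKP.dressing τ ∧
      CKP.lax (s * τ) = CKP.darbouxOp q Ω * CKP.lax τ * Ring.inverse (CKP.darbouxOp q Ω) := by
  refine ⟨CKP.exists_sq_eq Ω hΩ0, fun s hs => ?_⟩
  have hW := CKP.isCKPDressing_dressing hτ
  obtain ⟨u, hu, hu0, h1, h2, h3⟩ := CKP.exists_potential_symbol hτ hq hΩ
  have hdress : CKP.dressing (s * τ) = CKP.darbouxOp q Ω * CKP.dressing τ := by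
    rw [CKP.dressing, CKP.cwWave_mul_eq hτ hq hΩ hΩ0 hs hu0 h1 h2 h3, CKP.symbolOp_sub,
      CKP.symbolOp_inclHom_mul, hu, CKP.IsCKPDressing.darbouxOp_mul, CKP.dressing]
  have hτ' : CKP.IsCKPTau (s * τ) := by
    constructor
    · rw [map_mul]
      refine mul_ne_zero (fun h => hΩ0 ?_) hτ.1
      rw [← hs, map_pow, h]
      norm_num
    · rw [← CKP.bilinRes_symbolOp_eq_lamRes, ← CKP.dressing, hdress]
      exact hW.bilinRes_darbouxOp_mul hq hΩ hΩ0
  refine ⟨hτ', hdress, ?_⟩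
  obtain ⟨U, hU⟩ := hW.isUnit
  obtain ⟨V, hV⟩ := (CKP.isCKPDressing_dressing hτ').isUnit
  -- `T = W_{Ω^{1/2} τ} W_τ⁻¹` is a product of units
  have hT : CKP.darbouxOp q Ω = ((V * U⁻¹ : CKP.Opˣ) : CKP.Op) := by
    rw [Units.val_mul, Units.eq_mul_inv_iff_mul_eq, hU, ← hdress, hV]
  rw [CKP.lax, CKP.lax, hT, ← hU, ← hV, Ring.inverse_unit, Ring.inverse_unit, Ring.inverse_unit,
    mul_inv_rev, inv_inv, Units.val_mul, Units.val_mul]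
  simp only [mul_assoc, Units.inv_mul_cancel_left]
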